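/- Let $\Phi$ be a (finite) reduced crystallographic root system, not necessarily irreducible, with a chosen base, positive roots $\Phi^+$, negative roots $\Phi^-=-\Phi^+$, Weyl group $W$, length function $\ell(w)=\#\{\alpha\in\Phi^+ : w\alpha\in\Phi^-\}$, and let $2\rho$ be the sum of the positive roots. The quantum Bruhat graph of $W$ is the directed graph with vertex set $W$ and the following edges, for $w\in W$ and $\alpha\in\Phi^+$: a Bruhat edge $w\to ws_\alpha$ of weight $0$ if $\ell(ws_\alpha)=\ell(w)+1$, and a quantum edge $w\to ws_\alpha$ of weight $\alpha^\vee$ if $\ell(ws_\alpha)=\ell(w)+1-\langle\alpha^\vee,2\rho\rangle$. The weight of a path is the sum of the weights of its edges, an element of the coroot lattice $\mathbb Z\Phi^\vee$, and $\mathrm{wt}(w\Rightarrow w')\in\mathbb Z\Phi^\vee$ denotes the weight of a shortest path (one with the fewest edges) from $w$ to $w'$. For $w\in W$ put $\mathrm{inv}(w)=\{\alpha\in\Phi^+ : w^{-1}\alpha\in\Phi^-\}$. A maximal inversion of $w$ is an element $\gamma\in\mathrm{inv}(w)$ such that there is no $\alpha\in\mathrm{inv}(w)$ with $\alpha\neq\gamma$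 for which $\alpha-\gamma$ is a sum of positive roots. Proposition. Let $w\in W$. (1) If $\gamma$ is a maximal inversion of $w$, then $w\to s_\gamma w$ is a quantum edge. Moreover $\mathrm{wt}(w\Rightarrow 1)$ and $\mathrm{wt}(s_\gamma w\Rightarrow 1)$ are well defined (there is a shortest path, and all shortest paths have the same weight), and $$\mathrm{wt}(w\Rightarrow 1)=\mathrm{wt}(s_\gamma w\Rightarrow 1)-w^{-1}\gamma^\vee .$$ (2) This determines $\mathrm{wt}(w\Rightarrow 1)$ recursively: $\ell(s_\gamma w)<\ell(w)$ for every maximal inversion $\gamma$ of $w$, every $w\neq 1$ has a maximal inversion, and $\mathrm{wt}(1\Rightarrow 1)=0$. -/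

import Mathlib

noncomputable section

namespace QuantumBruhat

open RootPairing

variable {ι R M N : Type*} [CommRing R] [AddCommGroup M] [Module R M]
  [AddCommGroup N] [Module R N] {P : RootPairing ι R M N}

/-- The coroot lattice `ℤΦ^∨`. -/
abbrev CorootLattice (P : RootPairing ι R M N) : Submodule ℤ N :=
  Submodule.span ℤ (Set.range P.coroot)

/-- The coroot `α^∨` as an element of the coroot lattice. -/
def corootVec (P : RootPairing ι R M N) (α : ι) : CorootLattice P :=
  ⟨P.coroot α, Submodule.subset_span (Set.mem_range_self α)⟩

/-- The reflection `s_α` as an element of the Weyl group. -/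
abbrev refl (P : RootPairing ι R M N) (α : ι) : P.weylGroup :=
  weylGroup.ofIdx P α

/-- The Weyl group acts on (indices of) roots as it acts on the roots themselves. -/
theorem root_smul (P : RootPairing ι R M N) (w : P.weylGroup) (α : ι) :
    P.root (w • α) = w • P.root α :=
  (weylGroup_apply_root P w α).symm

/-- A reflection acts on coroots by `s_α (β^∨) = β^∨ - ⟨β^∨, α⟩ α^∨`; thus the coroot attached to
the root `w β` is the image `w β^∨` of the coroot of `β`. -/
theorem coroot_refl_smul (P : RootPairing ι R M N) (α β : ι) :
    P.coroot (refl P α • β) = P.coroot β - P.toLinearMap (P.root α) (P.coroot β) • P.coroot α :=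
  (P.reflectionPerm_coroot α β).symm

variable [CharZero R]

/-- The length `ℓ(w)`: the number of positive roots sent to negative roots by `w`. -/
def length (b : P.Base) (w : P.weylGroup) : ℕ :=
  Set.ncard {α : ι | b.IsPos α ∧ ¬ b.IsPos (w • α)}

/-- The sum `2ρ` of all positive roots. -/
def twoRho (b : P.Base) : M :=
  ∑ᶠ α ∈ {α : ι | b.IsPos α}, P.root α

/-- `w₁ → w₂ = w₁ s_α` is a Bruhat edge of the quantum Bruhat graph, labelled by `α`. -/
def IsBruhatEdge (b : P.Base) (w₁ w₂ : P.weylGroup) (α : ι) : Prop :=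
  b.IsPos α ∧ w₂ = w₁ * refl P α ∧ length b w₂ = length b w₁ + 1

/-- `w₁ → w₂ = w₁ s_α` is a quantum edge of the quantum Bruhat graph, labelled by `α`:
`ℓ(w₂) = ℓ(w₁) + 1 - ⟨α^∨, 2ρ⟩`. The equation is read in `R`, a ring of characteristic zero. -/
def IsQuantumEdge (b : P.Base) (w₁ w₂ : P.weylGroup) (α : ι) : Prop :=
  b.IsPos α ∧ w₂ = w₁ * refl P α ∧
    (length b w₂ : R) = length b w₁ + 1 - P.toLinearMap (twoRho b) (P.coroot α)

/-- `HasPath b w w' n μ`: there is a path from `w` to `w'` in the quantum Bruhat graph which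
consists of `n` edges and has weight `μ`. Bruhat edges have weight `0`, and the quantum edge
`w → w s_α` has weight `α^∨`. -/
inductive HasPath (b : P.Base) :
    P.weylGroup → P.weylGroup → ℕ → CorootLattice P → Prop
  | nil (w : P.weylGroup) : HasPath b w w 0 0
  | bruhat {w₁ w₂ w₃ : P.weylGroup} {α : ι} {n : ℕ} {μ : CorootLattice P}
      (e : IsBruhatEdge b w₁ w₂ α) (p : HasPath b w₂ w₃ n μ) : HasPath b w₁ w₃ (n + 1) μ
  | quantum {w₁ w₂ w₃ : P.weylGroup} {α : ι} {n : ℕ} {μ : CorootLattice P}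
      (e : IsQuantumEdge b w₁ w₂ α) (p : HasPath b w₂ w₃ n μ) :
      HasPath b w₁ w₃ (n + 1) (corootVec P α + μ)

/-- The distance `d(w ⇒ w')`: the infimum of the lengths of all paths from `w` to `w'`. -/
def dist (b : P.Base) (w w' : P.weylGroup) : ℕ∞ :=
  ⨅ n ∈ {n : ℕ | ∃ μ, HasPath b w w' n μ}, (n : ℕ∞)

/-- `μ` is the weight of some shortest path from `w` to `w'`. -/
def IsShortestWeight (b : P.Base) (w w' : P.weylGroup) (μ : CorootLattice P) : Prop :=
  ∃ n : ℕ, HasPath b w w' n μ ∧ (n : ℕ∞) = dist b w w'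

open Classical in
/-- The weight `wt(w ⇒ w')`: the weight of a shortest path from `w` to `w'` (and `0` if there were
none). That it is well defined is expressed by `∃! μ, IsShortestWeight b w w' μ`. -/
def wt (b : P.Base) (w w' : P.weylGroup) : CorootLattice P :=
  if h : ∃ μ, IsShortestWeight b w w' μ then h.choose else 0

/-- The set `inv(w)` of inversions of `w`: positive roots `α` such that `w⁻¹ α` is negative. -/
def inv (b : P.Base) (w : P.weylGroup) : Set ι :=
  {α | b.IsPos α ∧ ¬ b.IsPos (w⁻¹ • α)}

/-- `γ ≤ α`: the difference `α - γ` is a (possibly empty) sum of positive roots. -/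
def RootLE (b : P.Base) (γ α : ι) : Prop :=
  P.root α - P.root γ ∈ AddSubmonoid.closure (P.root '' {β : ι | b.IsPos β})

/-- The set of maximal inversions of `w`. -/
def maxInv (b : P.Base) (w : P.weylGroup) : Set ι :=
  {γ | γ ∈ inv b w ∧ ¬ ∃ α ∈ inv b w, α ≠ γ ∧ RootLE b γ α}

end QuantumBruhat

end

noncomputable section

set_option linter.unusedSectionVars false

namespace QuantumBruhat

open RootPairing

variable {ι R M N : Type*} [CommRing R] [AddCommGroup M] [Module R M]
  [AddCommGroup N] [Module R N] {P : RootPairing ι R M N}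

/-! ### The Weyl group action on roots and coroots. -/

section WeylAction

/-! The weight is obtained from a potential: a function `μ` on the Weyl group with `μ 1 = 0` such
that `μ u` is the weight of some path from `u` to `1`, and such that along any edge `u → v` the edge
weight plus `μ v - μ u` lies in the cone of positive coroots. Summing along a path, every path from
`u` to `1` has weight in `μ u` plus the cone (`IsPotential.sub_mem_posCone`). The number of edges of
a path is fixed by its endpoints and the pairing of its weight with `2ρ` (`HasPath.length_eq`), and
`2ρ` is strictly positive on nonzero elements of the cone. Hence the shortest paths to `1` are
exactly those of weight `μ u`, so any two global potentials agree and equal `wt`.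

A potential is built by folding. For an upward closed set `U` of positive roots, consider the
elements with no inversion in `U`. If `U \ {γ}` is also upward closed, a potential for `U` extends
to one for `U \ {γ}` by `μ u = μ (s_γ u) - u⁻¹γ^∨` whenever `γ` is an inversion of `u`
(`IsPotential.fold`). Such a `γ` is then a maximal inversion of `u`, and `u → s_γ u` is a quantum
edge (`IsUpper.length_refl_mul`), so the new values are attained. The edge inequality is checked
according to whether `γ` is an inversion of either endpoint. Starting from all positive roots, where
only `1` is allowed, and removing roots one at a time gives a potential on the whole group.

For the recursion at a maximal inversion `γ` of `w`, restrict a global potential to the `U` formed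
by the roots above `γ`, fold along `γ`, and extend the result to the whole group. Both global
potentials are `wt`, and by construction their values at `w` and `s_γ w` differ by the required
coroot. -/

theorem refl_smul (α β : ι) : refl P α • β = P.reflectionPerm α β := rfl

theorem root_refl_smul [P.IsCrystallographic] (α β : ι) :
    P.root (refl P α • β) = P.root β - P.pairingIn ℤ β α • P.root α := by
  rw [refl_smul, root_reflectionPerm, reflection_apply_root' ℤ]

theorem root_refl_smul_self (α : ι) : P.root (refl P α • α) = -P.root α := by
  rw [refl_smul, root_reflectionPerm, reflection_apply_self]

theorem smul_zsmul_root (w : P.weylGroup) (a : ℤ) (m : M) : w • (a • m) = a • w • m :=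
  map_zsmul (DistribSMul.toAddMonoidHom M w) a m

theorem root_smul_of_eq {i j k : ι} {a c : ℤ}
    (h : P.root k = a • P.root i + c • P.root j) (w : P.weylGroup) :
    P.root (w • k) = a • P.root (w • i) + c • P.root (w • j) := by
  simp only [root_smul, h, smul_add, smul_zsmul_root]

/-- Only linearity is needed: it transports integral relations among coroots by `w`. -/
theorem exists_linearMap_coroot_smul (w : P.weylGroup) :
    ∃ L : N →ₗ[R] N, ∀ i, P.coroot (w • i) = L (P.coroot i) := by
  obtain ⟨w, hw⟩ := w
  induction hw using weylGroup.induction with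
  | mem i => exact ⟨P.coreflection i, fun j ↦ P.coroot_reflectionPerm i j⟩
  | one => exact ⟨LinearMap.id, fun _ ↦ rfl⟩
  | mul x y hx hy hx' hy' =>
    obtain ⟨L, hL⟩ := hx'
    obtain ⟨L', hL'⟩ := hy'
    exact ⟨L ∘ₗ L', fun i ↦ by
      rw [LinearMap.comp_apply, ← hL', ← hL, ← mul_smul]; rfl⟩

theorem corootVec_refl_smul [P.IsCrystallographic] (α β : ι) :
    corootVec P (refl P α • β) = corootVec P β - P.pairingIn ℤ α β • corootVec P α := by
  apply Subtype.ext
  change P.coroot (refl P α • β) = P.coroot β - P.pairingIn ℤ α β • P.coroot α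
  rw [coroot_refl_smul, root_coroot_eq_pairing, ← P.algebraMap_pairingIn ℤ, algebraMap_smul]

theorem corootVec_smul_refl_smul [P.IsCrystallographic] (w : P.weylGroup) (α β : ι) :
    corootVec P (w • refl P α • β) =
      corootVec P (w • β) - P.pairingIn ℤ α β • corootVec P (w • α) := by
  obtain ⟨L, hL⟩ := exists_linearMap_coroot_smul w
  have := congrArg (fun x : CorootLattice P ↦ L x.1) (corootVec_refl_smul (P := P) α β)
  apply Subtype.ext
  change P.coroot _ = P.coroot _ - P.pairingIn ℤ α β • P.coroot _
  rw [hL, hL, hL, ← map_zsmul, ← map_sub]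
  exact this

theorem refl_smul_self_smul (α β : ι) : refl P α • refl P α • β = β :=
  P.reflectionPerm_self α β

theorem refl_mul_self (α : ι) : refl P α * refl P α = 1 := by
  apply Subtype.ext
  change Equiv.reflection P α * Equiv.reflection P α = 1
  rw [mul_eq_one_iff_inv_eq, Equiv.reflection_inv]

theorem refl_inv (α : ι) : (refl P α)⁻¹ = refl P α :=
  inv_eq_of_mul_eq_one_left (refl_mul_self α)

theorem weylGroup_ext {v w : P.weylGroup} (h : ∀ m : M, v • m = w • m) : v = w := by
  apply Subtype.ext
  apply Equiv.weightHom_injective P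
  ext m
  exact h m

theorem refl_smul_weight (α : ι) (m : M) : refl P α • m = P.reflection α m := rfl

theorem refl_refl_smul (α β : ι) : refl P (refl P α • β) = refl P α * refl P β * refl P α := by
  apply weylGroup_ext
  intro m
  rw [mul_smul, mul_smul, refl_smul_weight, refl_smul_weight, refl_smul_weight, refl_smul_weight,
    refl_smul, reflection_reflectionPerm]
  rfl

theorem refl_weyl_smul (w : P.weylGroup) (β : ι) : refl P (w • β) = w * refl P β * w⁻¹ := by
  obtain ⟨w, hw⟩ := w
  induction hw using weylGroup.induction generalizing β with
  | mem i =>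
    change refl P (refl P i • β) = refl P i * refl P β * (refl P i)⁻¹
    rw [refl_refl_smul, refl_inv]
  | one =>
    change refl P ((1 : P.weylGroup) • β) = 1 * refl P β * 1⁻¹
    simp
  | mul x y hx hy hx' hy' =>
    have : (⟨x * y, mul_mem hx hy⟩ : P.weylGroup) = ⟨x, hx⟩ * ⟨y, hy⟩ := rfl
    rw [this, mul_smul, hx', hy']
    group

theorem pairingIn_smul_smul [CharZero R] [P.IsCrystallographic] (w : P.weylGroup) (i j : ι) :
    P.pairingIn ℤ (w • i) (w • j) = P.pairingIn ℤ i j := by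
  obtain ⟨w, hw⟩ := w
  induction hw using weylGroup.induction generalizing i j with
  | mem k =>
    change P.pairingIn ℤ (P.reflectionPerm k i) (P.reflectionPerm k j) = _
    rw [pairingIn_reflectionPerm, reflectionPerm_self]
  | one => rfl
  | mul x y hx hy hx' hy' =>
    have : (⟨x * y, mul_mem hx hy⟩ : P.weylGroup) = ⟨x, hx⟩ * ⟨y, hy⟩ := rfl
    rw [this, mul_smul, mul_smul, hx', hy']

theorem refl_smul_self_eq_iff (α β : ι) : refl P α • α = β ↔ P.root β = -P.root α := by
  rw [← root_refl_smul_self]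
  exact ⟨fun h ↦ by rw [h], fun h ↦ P.root.injective h.symm⟩

theorem refl_eq_of_root_eq_neg {α β : ι} (h : P.root β = -P.root α) : refl P β = refl P α := by
  rw [← (refl_smul_self_eq_iff α β).2 h, refl_refl_smul, refl_mul_self, one_mul]

theorem smul_refl_smul_self (w : P.weylGroup) (α : ι) :
    w • refl P α • α = refl P (w • α) • w • α := by
  rw [refl_weyl_smul]
  simp only [mul_smul, inv_smul_smul]

end WeylAction

/-! ### Pairings with reflected roots. -/

section Pairing

variable [CharZero R] [P.IsCrystallographic]

theorem pairingIn_refl_left (α β γ : ι) : P.pairingIn ℤ (refl P α • β) γ =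
    P.pairingIn ℤ β γ - P.pairingIn ℤ β α * P.pairingIn ℤ α γ := by
  have := pairingIn_eq_add_of_root_eq_smul_add_smul (S := ℤ) (P := P) (j := γ)
    (k := refl P α • β) (i := β) (l := α) (x := 1) (y := -P.pairingIn ℤ β α)
    (by rw [root_refl_smul]; module)
  simpa [sub_eq_add_neg] using this

theorem pairingIn_refl_right (α β γ : ι) : P.pairingIn ℤ β (refl P α • γ) =
    P.pairingIn ℤ β γ - P.pairingIn ℤ β α * P.pairingIn ℤ α γ := by
  rw [refl_smul, pairingIn_reflectionPerm, ← refl_smul, pairingIn_refl_left]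

end Pairing

/-! ### Heights: the sign of a root as a linear inequality over the integers. -/

section Height

variable [CharZero R] (b : P.Base)

theorem height_of_eq {i j k : ι} {a c : ℤ} (hk : P.root k = a • P.root i + c • P.root j) :
    b.height k = a * b.height i + c * b.height j := by
  obtain ⟨f, -, -, hf⟩ := b.exists_root_eq_sum_int i
  obtain ⟨g, -, -, hg⟩ := b.exists_root_eq_sum_int j
  have hfg : P.root k = ∑ l ∈ b.support, (a • f + c • g) l • P.root l := by
    simp_rw [Pi.add_apply, Pi.smul_apply, add_smul, smul_assoc, Finset.sum_add_distrib,
      ← Finset.smul_sum, ← hf, ← hg, hk]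
  simp_rw [Base.height_eq_sum hf, Base.height_eq_sum hg, Base.height_eq_sum hfg, Pi.add_apply,
    Pi.smul_apply, Finset.sum_add_distrib, smul_eq_mul, Finset.mul_sum]

theorem height_smul_of_eq {i j k : ι} {a c : ℤ} (hk : P.root k = a • P.root i + c • P.root j)
    (w : P.weylGroup) :
    b.height (w • k) = a * b.height (w • i) + c * b.height (w • j) :=
  height_of_eq b (root_smul_of_eq hk w)

theorem height_refl_smul [P.IsCrystallographic] (α β : ι) :
    b.height (refl P α • β) = b.height β - P.pairingIn ℤ β α * b.height α := by
  rw [height_of_eq b (i := β) (j := α) (a := 1) (c := -P.pairingIn ℤ β α)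
    (by rw [root_refl_smul]; module)]
  ring

theorem height_smul_refl_smul [P.IsCrystallographic] (w : P.weylGroup) (α β : ι) :
    b.height (w • refl P α • β) =
      b.height (w • β) - P.pairingIn ℤ β α * b.height (w • α) := by
  rw [height_smul_of_eq b (i := β) (j := α) (a := 1) (c := -P.pairingIn ℤ β α)
    (by rw [root_refl_smul]; module)]
  ring

theorem height_refl_smul_self (α : ι) : b.height (refl P α • α) = -b.height α := by
  rw [height_of_eq b (i := α) (j := α) (a := -1) (c := 0) (by rw [root_refl_smul_self]; module)]
  ring

theorem height_smul_refl_smul_self (w : P.weylGroup) (α : ι) :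
    b.height (w • refl P α • α) = -b.height (w • α) := by
  rw [smul_refl_smul_self, height_refl_smul_self]

theorem height_pos_or_neg (α : ι) : 0 < b.height α ∨ b.height α < 0 :=
  (b.height_ne_zero α).symm.lt_or_gt

end Height

/-! ### Lengths of `u` and `u s_x`, compared over the inversions of `s_x`. -/

section Length

variable (P) in
/-- The index of the root `-s_α(β)`. -/
def negRefl (α β : ι) : ι := refl P α • refl P β • β

theorem root_negRefl (α β : ι) : P.root (negRefl P α β) = -P.root (refl P α • β) := by
  rw [negRefl, root_smul, root_refl_smul_self, smul_neg, ← root_smul]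

theorem negRefl_negRefl (α β : ι) : negRefl P α (negRefl P α β) = β := by
  apply P.root.injective
  rw [root_negRefl, root_smul, root_negRefl, smul_neg, ← root_smul, refl_smul_self_smul, neg_neg]

theorem negRefl_self (α : ι) : negRefl P α α = α := refl_smul_self_smul α α

variable [CharZero R] (b : P.Base)

theorem height_smul_negRefl (w : P.weylGroup) (α β : ι) :
    b.height (w • negRefl P α β) = -b.height (w • refl P α • β) := by
  rw [height_smul_of_eq b (i := refl P α • β) (j := α) (a := -1) (c := 0)
    (by rw [root_negRefl]; module)]
  ring

theorem height_negRefl (α β : ι) :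
    b.height (negRefl P α β) = -b.height (refl P α • β) := by
  simpa using height_smul_negRefl b 1 α β

variable [Finite ι]

/-- The finite set of positive roots. -/
def posRoots : Finset ι := (Set.toFinite {z | 0 < b.height z}).toFinset

/-- The positive roots made negative by the reflection `s_x`. -/
def flipped (x : ι) : Finset ι :=
  (Set.toFinite {z | 0 < b.height z ∧ b.height (refl P x • z) < 0}).toFinset

/-- The integer `⟨x^∨, 2ρ⟩`. -/
def rhoPairing [P.IsCrystallographic] (x : ι) : ℤ := ∑ z ∈ posRoots b, P.pairingIn ℤ z x

@[simp] theorem mem_posRoots {z : ι} : z ∈ posRoots b ↔ 0 < b.height z := by simp [posRoots]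

@[simp] theorem mem_flipped {x z : ι} :
    z ∈ flipped b x ↔ 0 < b.height z ∧ b.height (refl P x • z) < 0 := by simp [flipped]

theorem self_mem_flipped {x : ι} (hx : 0 < b.height x) : x ∈ flipped b x := by
  rw [mem_flipped, height_refl_smul_self]
  exact ⟨hx, by lia⟩

theorem negRefl_mem_flipped {x z : ι} (hz : z ∈ flipped b x) : negRefl P x z ∈ flipped b x := by
  rw [mem_flipped] at hz ⊢
  rw [height_smul_negRefl, height_negRefl, refl_smul_self_smul]
  lia

open Classical in
theorem length_eq_card (u : P.weylGroup) :
    length b u = ((posRoots b).filter fun z ↦ b.height (u • z) < 0).card := by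
  rw [length, ← Set.ncard_coe_finset]
  congr 1
  ext z
  have := b.height_ne_zero (u • z)
  simp only [Set.mem_ofPred_eq, Finset.coe_filter, mem_posRoots, Base.isPos_iff]
  constructor <;> rintro ⟨h₁, h₂⟩ <;> exact ⟨h₁, by lia⟩

open Classical in
theorem length_eq_add (u : P.weylGroup) (x : ι) :
    length b u = ((flipped b x).filter fun z ↦ b.height (u • z) < 0).card +
      ((posRoots b \ flipped b x).filter fun z ↦ b.height (u • z) < 0).card := by
  have h : flipped b x ⊆ posRoots b := fun z hz ↦ by
    rw [mem_flipped] at hz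
    exact (mem_posRoots b).2 hz.1
  rw [length_eq_card, ← Finset.card_union_of_disjoint]
  · rw [← Finset.filter_union, Finset.union_sdiff_of_subset h]
  · exact Finset.disjoint_filter_filter Finset.disjoint_sdiff

open Classical in
-- The reflection `s_x` permutes the positive roots it keeps positive, so these contribute equally
-- to both lengths. On the flipped ones, the involution `z ↦ -s_x z` exchanges being made negative
-- by `u s_x` with being kept positive by `u`.
theorem length_mul_refl_add (u : P.weylGroup) (x : ι) :
    length b (u * refl P x) + ((flipped b x).filter fun z ↦ b.height (u • z) < 0).card =
      length b u + ((flipped b x).filter fun z ↦ 0 < b.height (u • z)).card := by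
  rw [length_eq_add b (u * refl P x) x, length_eq_add b u x]
  have h₁ : ((flipped b x).filter fun z ↦ b.height ((u * refl P x) • z) < 0).card =
      ((flipped b x).filter fun z ↦ 0 < b.height (u • z)).card := by
    refine Finset.card_nbij' (negRefl P x) (negRefl P x) ?_ ?_ (fun z _ ↦ negRefl_negRefl x z)
      (fun z _ ↦ negRefl_negRefl x z)
    · intro z hz
      rw [Finset.mem_coe, Finset.mem_filter] at hz ⊢
      refine ⟨negRefl_mem_flipped b hz.1, ?_⟩
      rw [height_smul_negRefl, ← mul_smul]
      lia
    · intro z hz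
      rw [Finset.mem_coe, Finset.mem_filter] at hz ⊢
      refine ⟨negRefl_mem_flipped b hz.1, ?_⟩
      rw [height_smul_negRefl, mul_smul, refl_smul_self_smul]
      lia
  have h₂ : ((posRoots b \ flipped b x).filter fun z ↦ b.height ((u * refl P x) • z) < 0).card =
      ((posRoots b \ flipped b x).filter fun z ↦ b.height (u • z) < 0).card := by
    have key : ∀ z ∈ posRoots b \ flipped b x, refl P x • z ∈ posRoots b \ flipped b x := by
      intro z hz
      have := b.height_ne_zero (refl P x • z)
      simp only [Finset.mem_sdiff, mem_posRoots, mem_flipped, refl_smul_self_smul] at hz ⊢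
      lia
    refine Finset.card_nbij' (refl P x • ·) (refl P x • ·) ?_ ?_
      (fun z _ ↦ refl_smul_self_smul x z) (fun z _ ↦ refl_smul_self_smul x z)
    · intro z hz
      rw [Finset.mem_coe, Finset.mem_filter] at hz ⊢
      exact ⟨key z hz.1, by simpa only [mul_smul] using hz.2⟩
    · intro z hz
      rw [Finset.mem_coe, Finset.mem_filter] at hz ⊢
      exact ⟨key z hz.1, by simpa only [mul_smul, refl_smul_self_smul] using hz.2⟩
  rw [h₁, h₂]
  ring

open Classical in
theorem card_filter_flipped (u : P.weylGroup) (x : ι) :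
    ((flipped b x).filter fun z ↦ b.height (u • z) < 0).card +
      ((flipped b x).filter fun z ↦ 0 < b.height (u • z)).card = (flipped b x).card := by
  rw [← Finset.card_filter_add_card_filter_not (s := flipped b x)
    (fun z ↦ b.height (u • z) < 0)]
  congr 2
  refine Finset.filter_congr fun z _ ↦ ?_
  have := b.height_ne_zero (u • z)
  lia

variable [P.IsCrystallographic]

theorem pairingIn_pos_of_mem_flipped {x z : ι} (hx : 0 < b.height x) (hz : z ∈ flipped b x) :
    0 < P.pairingIn ℤ z x := by
  rw [mem_flipped, height_refl_smul] at hz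
  by_contra! h
  nlinarith

/-- The involution `z ↦ -s_x z` injects the flipped roots made negative by `u` into those kept
positive, missing `x`. If the length rises by exactly one, this injection is onto everything but
`x`, which is the second conclusion. -/
theorem length_lt_length_mul_refl {u : P.weylGroup} {x : ι} (hx : 0 < b.height x)
    (hu : 0 < b.height (u • x)) : length b u < length b (u * refl P x) ∧
      (length b (u * refl P x) = length b u + 1 → ∀ z, z ≠ x → 0 < b.height z →
        b.height (refl P x • z) < 0 → 0 < b.height (u • z) →
        0 < b.height (u • refl P x • z)) := by
  classical
  have key := length_mul_refl_add b u x
  set B := (flipped b x).filter fun z ↦ b.height (u • z) < 0 with hB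
  set A := (flipped b x).filter fun z ↦ 0 < b.height (u • z) with hA
  have hxA : x ∈ A := by simp only [hA, Finset.mem_filter]; exact ⟨self_mem_flipped b hx, hu⟩
  have hinj : Set.InjOn (negRefl P x) B := fun z _ z' _ h ↦ by
    rw [← negRefl_negRefl (P := P) x z, h, negRefl_negRefl]
  have hsub : B.image (negRefl P x) ⊆ A.erase x := by
    intro y hy
    obtain ⟨z, hz, rfl⟩ := Finset.mem_image.1 hy
    rw [hB, Finset.mem_filter] at hz
    have hp := pairingIn_pos_of_mem_flipped b hx hz.1
    rw [Finset.mem_erase, hA, Finset.mem_filter]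
    refine ⟨fun h ↦ ?_, negRefl_mem_flipped b hz.1, ?_⟩
    · have : z = x := by rw [← negRefl_negRefl (P := P) x z, h, negRefl_self]
      rw [this] at hz
      lia
    · rw [height_smul_negRefl, height_smul_refl_smul]
      nlinarith
  have hcard : (B.image (negRefl P x)).card = B.card := Finset.card_image_of_injOn hinj
  have hle := Finset.card_le_card hsub
  have herase := Finset.card_erase_add_one hxA
  refine ⟨by lia, fun h z hzx hz₁ hz₂ hz₃ ↦ ?_⟩
  have heq := Finset.eq_of_subset_of_card_le hsub (by lia)
  have hzA : z ∈ A.erase x := by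
    rw [Finset.mem_erase, hA, Finset.mem_filter, mem_flipped]
    exact ⟨hzx, ⟨hz₁, hz₂⟩, hz₃⟩
  rw [← heq] at hzA
  obtain ⟨y, hy, rfl⟩ := Finset.mem_image.1 hzA
  rw [hB, Finset.mem_filter] at hy
  have : b.height (u • refl P x • negRefl P x y) = -b.height (u • y) := by
    have := height_smul_negRefl b u x (negRefl P x y)
    rw [negRefl_negRefl] at this
    lia
  lia

/-- On the positive roots that stay positive, `s_x` is a permutation negating the pairing with
`x^∨`, so their contribution vanishes. -/
theorem rhoPairing_eq_sum_flipped (x : ι) :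
    rhoPairing b x = ∑ z ∈ flipped b x, P.pairingIn ℤ z x := by
  classical
  have h : flipped b x ⊆ posRoots b := fun z hz ↦ by
    rw [mem_flipped] at hz
    exact (mem_posRoots b).2 hz.1
  have hzero : ∑ z ∈ posRoots b \ flipped b x, P.pairingIn ℤ z x = 0 := by
    have key : ∀ z ∈ posRoots b \ flipped b x, refl P x • z ∈ posRoots b \ flipped b x := by
      intro z hz
      have := b.height_ne_zero (refl P x • z)
      simp only [Finset.mem_sdiff, mem_posRoots, mem_flipped, refl_smul_self_smul] at hz ⊢
      lia
    have : ∑ z ∈ posRoots b \ flipped b x, P.pairingIn ℤ z x =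
        ∑ z ∈ posRoots b \ flipped b x, -P.pairingIn ℤ z x :=
      Finset.sum_nbij' (refl P x • ·) (refl P x • ·) key key
        (fun z _ ↦ refl_smul_self_smul x z) (fun z _ ↦ refl_smul_self_smul x z)
        (fun z _ ↦ by rw [pairingIn_refl_left, pairingIn_same]; ring)
    rw [Finset.sum_neg_distrib] at this
    lia
  rw [rhoPairing, ← Finset.sum_sdiff h, hzero, zero_add]

open Classical in
theorem rhoPairing_eq_add {x : ι} (hx : 0 < b.height x) :
    rhoPairing b x = (flipped b x).card + 1 +
      ∑ z ∈ (flipped b x).erase x, (P.pairingIn ℤ z x - 1) := by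
  have hx' := self_mem_flipped b hx
  rw [rhoPairing_eq_sum_flipped, ← Finset.add_sum_erase _ _ hx', Finset.sum_sub_distrib,
    pairingIn_same, ← Finset.card_erase_add_one hx']
  simp
  ring

-- The two correction terms on the right are nonnegative. They measure the failure of `u → u s_x` to
-- be a quantum edge, and their simultaneous vanishing is the criterion used later.
open Classical in
theorem length_mul_refl_add_rhoPairing (u : P.weylGroup) {x : ι} (hx : 0 < b.height x) :
    (length b (u * refl P x) : ℤ) + rhoPairing b x = length b u + 1 +
      2 * ((flipped b x).filter fun z ↦ 0 < b.height (u • z)).card +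
      ∑ z ∈ (flipped b x).erase x, (P.pairingIn ℤ z x - 1) := by
  have h₁ := length_mul_refl_add b u x
  have h₂ := card_filter_flipped b u x
  rw [rhoPairing_eq_add b hx]
  push_cast [← h₂]
  lia

open Classical in
theorem sum_flipped_erase_nonneg {x : ι} (hx : 0 < b.height x) :
    0 ≤ ∑ z ∈ (flipped b x).erase x, (P.pairingIn ℤ z x - 1) :=
  Finset.sum_nonneg fun z hz ↦ by
    have := pairingIn_pos_of_mem_flipped b hx (Finset.mem_of_mem_erase hz)
    lia

theorem two_le_rhoPairing {x : ι} (hx : 0 < b.height x) : 2 ≤ rhoPairing b x := by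
  classical
  have h := sum_flipped_erase_nonneg b hx
  have : 0 < (flipped b x).card := Finset.card_pos.2 ⟨x, self_mem_flipped b hx⟩
  rw [rhoPairing_eq_add b hx]
  lia

theorem le_length_mul_refl_add_rhoPairing (u : P.weylGroup) {x : ι} (hx : 0 < b.height x) :
    (length b u : ℤ) + 1 ≤ length b (u * refl P x) + rhoPairing b x := by
  classical
  have h := sum_flipped_erase_nonneg b hx
  rw [length_mul_refl_add_rhoPairing b u hx]
  lia

theorem length_mul_refl_add_rhoPairing_eq_iff (u : P.weylGroup) {x : ι} (hx : 0 < b.height x) :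
    (length b (u * refl P x) : ℤ) + rhoPairing b x = length b u + 1 ↔
      ∀ z, 0 < b.height z → b.height (refl P x • z) < 0 →
        b.height (u • z) < 0 ∧ (z ≠ x → P.pairingIn ℤ z x = 1) := by
  classical
  have h := sum_flipped_erase_nonneg b hx
  have hpos (z : ι) (hz : z ∈ (flipped b x).erase x) : 0 ≤ P.pairingIn ℤ z x - 1 := by
    have := pairingIn_pos_of_mem_flipped b hx (Finset.mem_of_mem_erase hz)
    lia
  rw [length_mul_refl_add_rhoPairing b u hx]
  constructor
  · intro heq z hz₁ hz₂
    have hzI : z ∈ flipped b x := (mem_flipped b).2 ⟨hz₁, hz₂⟩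
    have hA : ((flipped b x).filter fun z ↦ 0 < b.height (u • z)) = ∅ :=
      Finset.card_eq_zero.1 (by lia)
    have hS : ∑ z ∈ (flipped b x).erase x, (P.pairingIn ℤ z x - 1) = 0 := by lia
    rw [Finset.sum_eq_zero_iff_of_nonneg hpos] at hS
    refine ⟨?_, fun hzx ↦ by have := hS z (Finset.mem_erase.2 ⟨hzx, hzI⟩); lia⟩
    have := (Finset.filter_eq_empty_iff.1 hA) hzI
    have := b.height_ne_zero (u • z)
    lia
  · intro hI
    have hA : ((flipped b x).filter fun z ↦ 0 < b.height (u • z)) = ∅ :=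
      Finset.filter_eq_empty_iff.2 fun z hz ↦ by
        rw [mem_flipped] at hz
        have := (hI z hz.1 hz.2).1
        lia
    have hS : ∑ z ∈ (flipped b x).erase x, (P.pairingIn ℤ z x - 1) = 0 :=
      Finset.sum_eq_zero fun z hz ↦ by
        rw [Finset.mem_erase, mem_flipped] at hz
        have := (hI z hz.2.1 hz.2.2).2 hz.1
        lia
    rw [hA, hS]
    simp

theorem toLinearMap_twoRho_coroot (x : ι) :
    P.toLinearMap (twoRho b) (P.coroot x) = (rhoPairing b x : R) := by
  have : twoRho b = ∑ z ∈ posRoots b, P.root z := by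
    rw [twoRho, finsum_mem_eq_finite_toFinset_sum _ (Set.toFinite _)]
    rfl
  rw [this, rhoPairing, map_sum, LinearMap.sum_apply, Int.cast_sum]
  refine Finset.sum_congr rfl fun z _ ↦ ?_
  rw [root_coroot_eq_pairing, ← P.algebraMap_pairingIn ℤ, eq_intCast]

end Length

/-! ### Only the identity has no inversions. -/

section Faithful

variable [CharZero R] [IsDomain R] [Finite ι] [P.IsCrystallographic] [P.IsReduced] (b : P.Base)

theorem refl_mem_closure_simple (α : ι) :
    refl P α ∈ Submonoid.closure (refl P '' (b.support : Set ι)) := by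
  induction α using Base.induction_reflect (b := b) with
  | h₀ i hi =>
    have : refl P (P.reflectionPerm i i) = refl P i :=
      refl_eq_of_root_eq_neg (root_refl_smul_self i)
    rwa [this]
  | h₁ i hi => exact Submonoid.subset_closure ⟨i, hi, rfl⟩
  | h₂ i j hi hj =>
    have hj' := Submonoid.subset_closure (Set.mem_image_of_mem (refl P) hj)
    have : refl P (P.reflectionPerm j i) = refl P j * refl P i * refl P j := refl_refl_smul j i
    rw [this]
    exact mul_mem (mul_mem hj' hi) hj'

theorem mem_closure_simple (w : P.weylGroup) :
    w ∈ Submonoid.closure (refl P '' (b.support : Set ι)) := by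
  obtain ⟨w, hw⟩ := w
  induction hw using weylGroup.induction with
  | mem i => exact refl_mem_closure_simple b i
  | one => exact one_mem _
  | mul x y hx hy hx' hy' => exact mul_mem hx' hy'

theorem exists_simple_word (w : P.weylGroup) :
    ∃ l : List ι, (∀ i ∈ l, i ∈ b.support) ∧ (l.map (refl P)).prod = w := by
  induction mem_closure_simple b w using Submonoid.closure_induction with
  | mem x hx =>
    obtain ⟨j, hj, rfl⟩ := hx
    exact ⟨[j], by simpa using hj, by simp⟩
  | one => exact ⟨[], by simp, rfl⟩
  | mul x y hx hy hx' hy' =>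
    obtain ⟨l, hl₁, hl₂⟩ := hx'
    obtain ⟨l', hl₁', hl₂'⟩ := hy'
    refine ⟨l ++ l', fun i hi ↦ (List.mem_append.1 hi).elim (hl₁ i) (hl₁' i), ?_⟩
    rw [List.map_append, List.prod_append, hl₂, hl₂']

theorem exists_split_of_height_neg {l : List ι} (hl : ∀ i ∈ l, i ∈ b.support) {j : ι}
    (hj : 0 < b.height j) (h : b.height ((l.map (refl P)).prod • j) < 0) :
    ∃ l₁ i l₂, l = l₁ ++ i :: l₂ ∧ (l₂.map (refl P)).prod • j = i := by
  induction l with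
  | nil => simp at h; lia
  | cons a t ih =>
    rcases height_pos_or_neg b ((t.map (refl P)).prod • j) with h' | h'
    · refine ⟨[], a, t, rfl, ?_⟩
      by_contra hne
      have := Base.IsPos.reflectionPerm (b := b) h' (hl a (by simp)) hne
      rw [List.map_cons, List.prod_cons, mul_smul, refl_smul] at h
      rw [Base.isPos_iff] at this
      lia
    · obtain ⟨l₁, i, l₂, rfl, hi⟩ := ih (fun i hi ↦ hl i (List.mem_cons_of_mem _ hi)) h'
      exact ⟨a :: l₁, i, l₂, rfl, hi⟩

/-- The deletion argument: the last letter of a nonempty word cancels against an earlier one. Each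
cancellation removes two letters, hence the induction on a bound for the length. -/
theorem prod_eq_one_of_forall_height_pos (n : ℕ) : ∀ l : List ι, l.length ≤ n →
    (∀ i ∈ l, i ∈ b.support) →
    (∀ z, 0 < b.height z → 0 < b.height ((l.map (refl P)).prod • z)) →
    (l.map (refl P)).prod = 1 := by
  induction n with
  | zero =>
    intro l hn _ _
    rw [List.length_eq_zero_iff.1 (Nat.le_zero.1 hn)]
    rfl
  | succ n ih =>
    intro l hn hl hpos
    rcases List.eq_nil_or_concat l with rfl | ⟨t, j, rfl⟩
    · rfl
    have hj : j ∈ b.support := hl j (by simp)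
    have hj' : 0 < b.height j := Base.isPos_of_mem_support hj
    have hneg : b.height ((t.map (refl P)).prod • j) < 0 := by
      have := hpos j hj'
      rw [List.concat_eq_append, List.map_append, List.prod_append, mul_smul, List.map_singleton,
        List.prod_singleton, height_smul_refl_smul_self] at this
      lia
    obtain ⟨l₁, i, l₂, rfl, hi⟩ := exists_split_of_height_neg b
      (fun i hi ↦ hl i (by simp [hi])) hj' hneg
    -- With `v` the product of `l₂` and `i = v j`, one has `s_i v s_j = v s_j v⁻¹ v s_j = v`.
    have hprod : (((l₁ ++ i :: l₂).concat j).map (refl P)).prod =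
        ((l₁ ++ l₂).map (refl P)).prod := by
      simp only [List.concat_eq_append, List.map_append, List.prod_append, List.map_cons,
        List.prod_cons, List.map_nil, List.prod_nil, ← hi, refl_weyl_smul, mul_one]
      rw [mul_assoc (l₁.map (refl P)).prod, inv_mul_cancel_right, mul_assoc,
        refl_mul_self, mul_one]
    rw [hprod] at hpos ⊢
    refine ih (l₁ ++ l₂) ?_ (fun k hk ↦ hl k ?_) hpos
    · simp at hn ⊢; lia
    · rcases List.mem_append.1 hk with hk | hk <;> simp [hk]

theorem eq_one_of_forall_height_pos {w : P.weylGroup}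
    (h : ∀ z, 0 < b.height z → 0 < b.height (w • z)) : w = 1 := by
  obtain ⟨l, hl, rfl⟩ := exists_simple_word b w
  exact prod_eq_one_of_forall_height_pos b _ l le_rfl hl h

end Faithful

/-! ### Upward closed sets of positive roots and the elements avoiding them. -/

section UpperSets

variable [CharZero R] (b : P.Base)

/-- A set of positive roots closed under adding positive roots. -/
structure IsUpper (U : Set ι) : Prop where
  height_pos : ∀ σ ∈ U, 0 < b.height σ
  mem_of_le : ∀ σ ∈ U, ∀ τ, RootLE b σ τ → τ ∈ U

/-- The Weyl group elements having no inversions in `S`. -/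
def avoiding (S : Set ι) : Set P.weylGroup := {u | ∀ σ ∈ S, 0 < b.height (u⁻¹ • σ)}

variable {b}

theorem RootLE.of_eq {i j γ τ : ι} {a c : ℤ}
    (h : P.root τ = P.root γ + a • P.root i + c • P.root j) (ha : 0 ≤ a) (hc : 0 ≤ c)
    (hi : 0 < b.height i) (hj : 0 < b.height j) : RootLE b γ τ := by
  have key (k : ι) (hk : 0 < b.height k) (n : ℤ) (hn : 0 ≤ n) : n • P.root k ∈
      AddSubmonoid.closure (P.root '' {β : ι | b.IsPos β}) := by
    lift n to ℕ using hn
    rw [natCast_zsmul]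
    exact nsmul_mem (AddSubmonoid.subset_closure (Set.mem_image_of_mem P.root hk)) n
  rw [RootLE, h, add_assoc, add_sub_cancel_left]
  exact add_mem (key i hi a ha) (key j hj c hc)

/-- A sum of positive roots is either empty or has positive coefficient sum over the base; height
then makes the order strict and lets extremal roots be chosen by height. -/
theorem RootLE.eq_or_height_lt [P.IsCrystallographic] [IsDomain R] [P.IsReduced] [Finite ι]
    {σ τ : ι} (h : RootLE b σ τ) : σ = τ ∨ b.height σ < b.height τ := by
  have key : ∀ m ∈ AddSubmonoid.closure (P.root '' {β : ι | b.IsPos β}),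
      ∃ f : ι → ℤ, m = ∑ j ∈ b.support, f j • P.root j ∧
        (m = 0 ∨ 0 < ∑ j ∈ b.support, f j) := by
    intro m hm
    induction hm using AddSubmonoid.closure_induction with
    | mem x hx =>
      obtain ⟨j, hj, rfl⟩ := hx
      obtain ⟨f, -, -, hf⟩ := b.exists_root_eq_sum_int j
      refine ⟨f, hf, Or.inr ?_⟩
      rw [← Base.height_eq_sum hf]
      exact hj
    | zero => exact ⟨0, by simp, Or.inl rfl⟩
    | add x y hx hy hx' hy' =>
      obtain ⟨f, hf, hf'⟩ := hx'
      obtain ⟨g, hg, hg'⟩ := hy'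
      rcases hf' with rfl | hf'
      · exact ⟨g, by rw [zero_add, hg], by rwa [zero_add]⟩
      rcases hg' with rfl | hg'
      · exact ⟨f, by rw [add_zero, hf], by rw [add_zero]; exact Or.inr hf'⟩
      refine ⟨f + g, by simp [hf, hg, add_smul, Finset.sum_add_distrib], Or.inr ?_⟩
      simp only [Pi.add_apply, Finset.sum_add_distrib]
      lia
  obtain ⟨f, hf, hf'⟩ := key _ h
  rcases hf' with h0 | hf'
  · exact Or.inl (P.root.injective (sub_eq_zero.1 h0)).symm
  · obtain ⟨g, -, -, hg⟩ := b.exists_root_eq_sum_int σ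
    have : P.root τ = ∑ j ∈ b.support, (f + g) j • P.root j := by
      simp only [Pi.add_apply, add_smul, Finset.sum_add_distrib, ← hf, ← hg]
      abel
    right
    rw [Base.height_eq_sum hg, Base.height_eq_sum this]
    simp only [Pi.add_apply, Finset.sum_add_distrib]
    lia

theorem inv_refl_mul_smul (u : P.weylGroup) (α σ : ι) :
    (refl P α * u)⁻¹ • σ = u⁻¹ • refl P α • σ := by
  rw [mul_inv_rev, mul_smul, refl_inv]

variable {U : Set ι} {u : P.weylGroup} {γ : ι}

/-- The main source of contradictions below: once a root is exhibited as `γ` plus positive roots,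
`u⁻¹` must keep it positive. -/
theorem IsUpper.height_pos_of_eq (hU : IsUpper b U) (hγ : γ ∈ U)
    (hu : u ∈ avoiding b (U \ {γ})) {i j τ : ι} {a c : ℤ}
    (h : P.root τ = P.root γ + a • P.root i + c • P.root j) (ha : 0 ≤ a) (hc : 0 ≤ c)
    (hi : 0 < b.height i) (hj : 0 < b.height j) (hτ : τ ≠ γ) : 0 < b.height (u⁻¹ • τ) :=
  hu τ ⟨hU.mem_of_le γ hγ τ (RootLE.of_eq h ha hc hi hj), hτ⟩

theorem mem_avoiding_of_diff (hu : u ∈ avoiding b (U \ {γ})) (h : 0 < b.height (u⁻¹ • γ)) :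
    u ∈ avoiding b U := fun σ hσ ↦ by
  by_cases hσγ : σ = γ
  · rwa [hσγ]
  · exact hu σ ⟨hσ, hσγ⟩

theorem avoiding_subset_diff : avoiding b U ⊆ avoiding b (U \ {γ}) :=
  fun _ hu σ hσ ↦ hu σ hσ.1

variable [P.IsCrystallographic]

/-- In `s_η σ = σ - ⟨σ, η^∨⟩ η`, a negative pairing moves `σ` up inside `U`. A nonnegative one only
adds to the height after applying `u⁻¹`, since `u⁻¹η` is negative. -/
theorem IsUpper.refl_mul_mem_avoiding (hU : IsUpper b U) (hu : u ∈ avoiding b U) {η : ι}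
    (hη : 0 < b.height η) (hη' : b.height (u⁻¹ • η) < 0) : refl P η * u ∈ avoiding b U := by
  intro σ hσ
  rw [inv_refl_mul_smul]
  have hσu := hu σ hσ
  rcases le_or_gt 0 (P.pairingIn ℤ σ η) with h | h
  · rw [height_smul_refl_smul]
    nlinarith
  · refine hu _ (hU.mem_of_le σ hσ _ (RootLE.of_eq (i := η) (j := η)
      (a := -P.pairingIn ℤ σ η) (c := 0) ?_ (by lia) le_rfl hη hη))
    rw [root_refl_smul]
    module

theorem IsUpper.refl_mul_mem_avoiding_of_neg (hU : IsUpper b U) (hγ : γ ∈ U)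
    (hS : IsUpper b (U \ {γ})) (hu : u ∈ avoiding b (U \ {γ}))
    (h : b.height (u⁻¹ • γ) < 0) : refl P γ * u ∈ avoiding b U := by
  refine mem_avoiding_of_diff (γ := γ) (hS.refl_mul_mem_avoiding hu (hU.height_pos γ hγ) h) ?_
  rw [inv_refl_mul_smul, height_smul_refl_smul_self]
  lia

end UpperSets

/-! ### Edges of both kinds, and how they interact with the root `γ`. -/

section Edges

variable [CharZero R] [Finite ι] [P.IsCrystallographic] (b : P.Base)

/-- The multiplicity of the coroot of `u⁻¹ d` in the weight of an edge from `u` to `s_d u`. -/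
def deg (d : ι) : ℤ := if 0 < b.height d then 0 else 1

/-- `u → s_d u` is an edge of the quantum Bruhat graph, labelled by the positive root `u⁻¹ d`. -/
def IsEdge (u : P.weylGroup) (d : ι) : Prop :=
  0 < b.height (u⁻¹ • d) ∧
    (length b (refl P d * u) : ℤ) + deg b d * rhoPairing b (u⁻¹ • d) = length b u + 1

variable {b}

theorem deg_of_pos {d : ι} (h : 0 < b.height d) : deg b d = 0 := if_pos h

theorem deg_of_neg {d : ι} (h : b.height d < 0) : deg b d = 1 := if_neg (by lia)

theorem deg_cases (b : P.Base) (d : ι) :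
    (0 < b.height d ∧ deg b d = 0) ∨ (b.height d < 0 ∧ deg b d = 1) :=
  (height_pos_or_neg b d).imp (fun h ↦ ⟨h, deg_of_pos h⟩) (fun h ↦ ⟨h, deg_of_neg h⟩)

theorem mul_refl_inv_smul (u : P.weylGroup) (d : ι) :
    u * refl P (u⁻¹ • d) = refl P d * u := by
  rw [refl_weyl_smul]
  group

/-- Bruhat and quantum edges are the equality cases of this one bound. Hence when a chain of such
bounds has the right total, every step in it is an edge. -/
theorem length_add_one_le {u : P.weylGroup} {d : ι} (h : 0 < b.height (u⁻¹ • d)) :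
    (length b u : ℤ) + 1 ≤ length b (refl P d * u) + deg b d * rhoPairing b (u⁻¹ • d) := by
  rcases deg_cases b d with ⟨hd, hd'⟩ | ⟨hd, hd'⟩ <;> rw [hd', ← mul_refl_inv_smul]
  · have := (length_lt_length_mul_refl b h (u := u) (by rwa [smul_inv_smul])).1
    lia
  · rw [one_mul]
    exact le_length_mul_refl_add_rhoPairing b u h

theorem rhoPairing_smul_refl_smul (w : P.weylGroup) (α β : ι) :
    rhoPairing b (w • refl P α • β) =
      rhoPairing b (w • β) - P.pairingIn ℤ α β * rhoPairing b (w • α) := by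
  have key (z i : ι) : P.pairingIn ℤ z (w • i) = P.pairingIn ℤ (w⁻¹ • z) i := by
    rw [← pairingIn_smul_smul w (w⁻¹ • z) i, smul_inv_smul]
  simp only [rhoPairing, key, pairingIn_refl_right, Finset.sum_sub_distrib, Finset.mul_sum]
  congr 1
  exact Finset.sum_congr rfl fun _ _ ↦ mul_comm _ _

theorem rhoPairing_smul_refl_smul_self (w : P.weylGroup) (α : ι) :
    rhoPairing b (w • refl P α • α) = -rhoPairing b (w • α) := by
  rw [rhoPairing_smul_refl_smul, pairingIn_same]
  ring

theorem IsEdge.of_le {u : P.weylGroup} {d : ι} (h : 0 < b.height (u⁻¹ • d))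
    (hle : (length b (refl P d * u) : ℤ) + deg b d * rhoPairing b (u⁻¹ • d) ≤ length b u + 1) :
    IsEdge b u d := ⟨h, le_antisymm hle (length_add_one_le h)⟩

variable [IsDomain R] [P.IsReduced]

theorem pairingIn_cases {i j : ι} (h₁ : i ≠ j) (h₂ : P.root i ≠ -P.root j) :
    (P.pairingIn ℤ i j = 0 ∧ P.pairingIn ℤ j i = 0) ∨
    (P.pairingIn ℤ i j = 1 ∧ 0 < P.pairingIn ℤ j i) ∨
    (P.pairingIn ℤ j i = 1 ∧ 0 < P.pairingIn ℤ i j) ∨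
    (P.pairingIn ℤ i j = -1 ∧ P.pairingIn ℤ j i < 0) ∨
    (P.pairingIn ℤ j i = -1 ∧ P.pairingIn ℤ i j < 0) := by
  have := P.pairingIn_pairingIn_mem_set_of_isCrystal_of_isRed' i j
    (fun h ↦ h₁ (P.root.injective h)) h₂
  simp only [Set.mem_insert_iff, Set.mem_singleton_iff, Prod.mk.injEq] at this
  rcases this with h | h | h | h | h | h | h | h | h | h | h <;> lia

variable {U : Set ι} {u : P.weylGroup} {γ d : ι}

/-- Reflecting in a maximal inversion is a quantum edge. -/
theorem IsUpper.length_refl_mul (hU : IsUpper b U) (hγ : γ ∈ U)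
    (hu : u ∈ avoiding b (U \ {γ})) (h : b.height (u⁻¹ • γ) < 0) :
    (length b (refl P γ * u) : ℤ) - rhoPairing b (u⁻¹ • γ) = length b u + 1 := by
  have hγ0 := hU.height_pos γ hγ
  set x := u⁻¹ • refl P γ • γ with hx
  have hx0 : 0 < b.height x := by rw [hx, height_smul_refl_smul_self]; lia
  have hux : u * refl P x = refl P γ * u := by
    rw [hx, mul_refl_inv_smul, refl_eq_of_root_eq_neg (root_refl_smul_self γ)]
  have hρ : rhoPairing b (u⁻¹ • γ) = -rhoPairing b x := by
    rw [hx, rhoPairing_smul_refl_smul_self, neg_neg]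
  rw [hρ, ← hux, sub_neg_eq_add, length_mul_refl_add_rhoPairing_eq_iff b u hx0]
  have hrefl (z : ι) : refl P x • z = u⁻¹ • refl P γ • u • z := by
    rw [hx, refl_weyl_smul, refl_eq_of_root_eq_neg (root_refl_smul_self γ)]
    simp only [mul_smul, inv_inv]
  have key : ∀ z, 0 < b.height z → b.height (refl P x • z) < 0 →
      P.pairingIn ℤ (u • z) γ < 0 ∧ b.height (u • z) < 0 := by
    intro z hz₁ hz₂
    have hz₃ := hz₂
    rw [hrefl, height_smul_refl_smul, inv_smul_smul] at hz₃
    have hk : P.pairingIn ℤ (u • z) γ < 0 := by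
      by_contra! hk
      nlinarith
    refine ⟨hk, ?_⟩
    by_contra! hz
    have hz' : 0 < b.height (u • z) := lt_of_le_of_ne hz (b.height_ne_zero _).symm
    have := hU.height_pos_of_eq hγ hu (τ := refl P γ • u • z) (i := u • z) (j := γ) (a := 1)
      (c := -P.pairingIn ℤ (u • z) γ - 1) (by rw [root_refl_smul]; module) (by lia) (by lia)
      hz' hγ0 (fun h ↦ by
        have := congrArg b.height h
        rw [height_refl_smul] at this
        nlinarith)
    rw [hrefl] at hz₂
    lia
  intro z hz₁ hz₂
  obtain ⟨hk, hneg⟩ := key z hz₁ hz₂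
  refine ⟨hneg, fun hzx ↦ ?_⟩
  have hpair : P.pairingIn ℤ z x = -P.pairingIn ℤ (u • z) γ := by
    rw [← pairingIn_smul_smul u, hx, smul_inv_smul, pairingIn_refl_right, pairingIn_same]
    ring
  rw [hpair]
  by_contra hk1
  -- now `-u z` and `u s_x z` are positive roots adding up to a multiple `≥ 2` of `γ`
  have hγz : P.root γ ≠ -P.root (u • z) := fun h ↦ hzx <| by
    rw [hx, (refl_smul_self_eq_iff γ (u • z)).2 (by rw [h, neg_neg]), inv_smul_smul]
  obtain ⟨ε, hε⟩ := P.root_add_root_mem_of_pairingIn_neg hk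
    (fun h ↦ hγz (by rw [h, neg_neg]))
  rcases height_pos_or_neg b ε with hε0 | hε0
  · have := hU.height_pos_of_eq hγ hu (τ := refl P γ • u • z) (i := ε) (j := γ) (a := 1)
      (c := -P.pairingIn ℤ (u • z) γ - 2) (by rw [root_refl_smul, hε]; module) (by lia) (by lia)
      hε0 hγ0 (fun h ↦ by
        have := congrArg b.height h
        rw [height_refl_smul] at this
        have hε1 := b.height_add hε
        have hk2 : 0 ≤ -P.pairingIn ℤ (u • z) γ - 2 := by lia
        have := mul_nonneg hk2 hγ0.le
        nlinarith)
    rw [hrefl] at hz₂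
    lia
  -- Here `-u z = γ + (-ε)` lies above `γ`, yet `u⁻¹` sends it to the negative root `-z`.
  · have hε1 : 0 < b.height (refl P ε • ε) := by rw [height_refl_smul_self]; lia
    have := hU.height_pos_of_eq hγ hu (τ := refl P (u • z) • u • z) (i := refl P ε • ε)
      (j := γ) (a := 1) (c := 0) (by rw [root_refl_smul_self, root_refl_smul_self, hε]; module)
      (by lia) le_rfl hε1 hγ0 (fun h ↦ hγz (by rw [← root_refl_smul_self, h]))
    rw [height_smul_refl_smul_self, inv_smul_smul] at this
    lia

/-- When `γ` is an inversion of both ends of an edge, this is what allows the whole edge to be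
folded: the folded edge weighs no more than the change of the correction terms permits. A violation
would put `s_γ d` or `-d` above `γ`, or give `s_γ d` the wrong sign. -/
theorem IsUpper.deg_refl_smul_le (hU : IsUpper b U) (hγ : γ ∈ U)
    (hu : u ∈ avoiding b (U \ {γ})) (hu' : refl P d * u ∈ avoiding b (U \ {γ}))
    (hd : 0 < b.height (u⁻¹ • d)) (h : b.height (u⁻¹ • γ) < 0)
    (h' : b.height (u⁻¹ • refl P d • γ) < 0) :
    deg b (refl P γ • d) ≤ deg b d + P.pairingIn ℤ d γ := by
  have hγ0 := hU.height_pos γ hγ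
  have hdγ : d ≠ γ := by rintro rfl; lia
  have hdγ' : P.root d ≠ -P.root γ := fun hn ↦ by
    rw [refl_eq_of_root_eq_neg hn, height_smul_refl_smul_self] at h'
    lia
  set m := P.pairingIn ℤ d γ with hm
  set p := P.pairingIn ℤ γ d with hp
  have hpm := pairingIn_cases hdγ hdγ'
  rw [← hm, ← hp] at hpm
  have hτ : P.root (refl P γ • d) = P.root d - m • P.root γ := root_refl_smul γ d
  have hτ0 : b.height (refl P γ • d) = b.height d - m * b.height γ := height_refl_smul b γ d
  have hτu : b.height ((refl P d * u)⁻¹ • refl P γ • d) =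
      -b.height (u⁻¹ • d) - m * b.height (u⁻¹ • refl P d • γ) := by
    rw [height_smul_of_eq b (i := d) (j := γ) (a := 1) (c := -m) (by rw [hτ]; module),
      inv_refl_mul_smul, inv_refl_mul_smul, height_smul_refl_smul_self]
    ring
  have hγu : b.height (u⁻¹ • refl P d • γ) = b.height (u⁻¹ • γ) - p * b.height (u⁻¹ • d) :=
    height_smul_refl_smul b u⁻¹ d γ
  -- if `γ + d` is a root, then it is positive, unless `d` is
  have hsum (hdneg : b.height d < 0) (ε : ι) (hε : P.root ε = P.root γ + P.root d) :
      0 < b.height ε := by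
    by_contra! hneg
    have hε0 : 0 < b.height (refl P ε • ε) := by
      rw [height_refl_smul_self]
      have := b.height_ne_zero ε
      lia
    have := hU.height_pos_of_eq hγ hu (τ := refl P d • d) (i := refl P ε • ε) (j := γ) (a := 1)
      (c := 0) (by rw [root_refl_smul_self, root_refl_smul_self, hε]; module) (by lia) le_rfl
      hε0 hγ0 (fun hn ↦ hdγ' (by rw [← hn, root_refl_smul_self, neg_neg]))
    rw [height_smul_refl_smul_self] at this
    lia
  rcases deg_cases b d with ⟨hd0, hd1⟩ | ⟨hd0, hd1⟩ <;> rw [hd1] <;>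
    rcases deg_cases b (refl P γ • d) with ⟨he0, he1⟩ | ⟨he0, he1⟩ <;> rw [he1]
  · by_contra! hneg
    have := hU.height_pos_of_eq hγ hu' (τ := refl P γ • d) (i := d) (j := γ) (a := 1)
      (c := -m - 1) (by rw [hτ]; module) (by lia) (by lia) hd0 hγ0
      (fun hn ↦ by rw [hn] at hτ0; nlinarith)
    nlinarith
  · by_contra! hneg
    nlinarith
  · by_contra! hneg
    have hp1 : p = -1 := by lia
    have hε := hsum hd0 (refl P d • γ) (by rw [root_refl_smul, ← hp, hp1]; module)
    have := hU.height_pos_of_eq hγ hu' (τ := refl P γ • d) (i := refl P d • γ) (j := γ) (a := 1)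
      (c := -m - 2) (by rw [hτ, root_refl_smul, ← hp, hp1]; module) (by lia) (by lia) hε hγ0
      (fun hn ↦ by
        rw [hn] at hτ0
        rw [height_refl_smul, ← hp, hp1] at hε
        nlinarith)
    rw [hp1] at hγu
    nlinarith
  · by_contra! hneg
    rcases eq_or_ne m (-1) with hm1 | hm1
    · have := hsum hd0 (refl P γ • d) (by rw [hτ, hm1]; module)
      lia
    · have hp1 : p = -1 := by lia
      have hε := hsum hd0 (refl P d • γ) (by rw [root_refl_smul, ← hp, hp1]; module)
      rw [height_refl_smul, ← hp, hp1] at hε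
      nlinarith

/-- The only edge that removes the inversion `γ` is the quantum edge `u → s_γ u`. For any other,
either `s_d γ` or `-d` would be a root above `γ` with the wrong sign. -/
theorem IsUpper.root_eq_neg_of_isEdge (hU : IsUpper b U) (hγ : γ ∈ U)
    (hu : u ∈ avoiding b (U \ {γ})) (hu' : refl P d * u ∈ avoiding b (U \ {γ}))
    (hd : IsEdge b u d) (h : b.height (u⁻¹ • γ) < 0) (h' : 0 < b.height (u⁻¹ • refl P d • γ)) :
    P.root d = -P.root γ := by
  by_contra hdγ
  have hγ0 := hU.height_pos γ hγ
  obtain ⟨hd0, hd⟩ := hd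
  set p := P.pairingIn ℤ γ d with hp
  have hγu : b.height (u⁻¹ • refl P d • γ) = b.height (u⁻¹ • γ) - p * b.height (u⁻¹ • d) :=
    height_smul_refl_smul b u⁻¹ d γ
  have hp0 : p < 0 := by
    by_contra! hp0
    nlinarith
  rcases deg_cases b d with ⟨hd1, hd2⟩ | ⟨hd1, hd2⟩
  · have := hU.height_pos_of_eq hγ hu' (τ := refl P d • γ) (i := d) (j := d) (a := -p) (c := 0)
      (by rw [root_refl_smul]; module) (by lia) le_rfl hd1 hd1 (fun hn ↦ by
        have := congrArg b.height hn
        rw [height_refl_smul] at this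
        nlinarith)
    rw [inv_refl_mul_smul, refl_smul_self_smul] at this
    lia
  · rw [hd2, one_mul, ← mul_refl_inv_smul, length_mul_refl_add_rhoPairing_eq_iff b u hd0] at hd
    have hrefl (z : ι) : refl P (u⁻¹ • d) • u⁻¹ • z = u⁻¹ • refl P d • z := by
      rw [refl_weyl_smul]
      simp only [mul_smul, inv_inv, smul_inv_smul]
    -- The quantum edge criterion is tested on `-u⁻¹γ`, which gives `⟨γ, d^∨⟩ = -1`, and then on
    -- `u⁻¹ s_d γ`, which makes `s_d γ = γ + d` negative.
    have h₁ := (hd (u⁻¹ • refl P γ • γ) (by rw [height_smul_refl_smul_self]; lia) (by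
      rw [hrefl, height_smul_of_eq b (i := refl P d • γ) (j := γ) (a := -1) (c := 0)]
      · lia
      · rw [root_smul, root_refl_smul_self, smul_neg, ← root_smul]; module)).2 (fun hn ↦ hdγ <| by
        rw [← smul_left_cancel _ hn, root_refl_smul_self])
    have h₂ := (hd (u⁻¹ • refl P d • γ) h' (by rwa [hrefl, refl_smul_self_smul])).1
    rw [smul_inv_smul] at h₂
    rw [pairingIn_smul_smul, pairingIn_refl_left, pairingIn_same] at h₁
    have hp1 : p = -1 := by lia
    have hε0 : 0 < b.height (refl P (refl P d • γ) • refl P d • γ) := by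
      rw [height_refl_smul_self]
      lia
    have := hU.height_pos_of_eq hγ hu (τ := refl P d • d)
      (i := refl P (refl P d • γ) • refl P d • γ) (j := γ) (a := 1) (c := 0)
      (by rw [root_refl_smul_self, root_refl_smul_self, root_refl_smul, ← hp, hp1]; module)
      (by lia) le_rfl hε0 hγ0 (fun hn ↦ hdγ (by rw [← hn, root_refl_smul_self, neg_neg]))
    rw [height_smul_refl_smul_self] at this
    lia

theorem IsUpper.eq_or_pos_of_isEdge (hU : IsUpper b U) (hγ : γ ∈ U)
    (hu : u ∈ avoiding b (U \ {γ}))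
    (hd : IsEdge b u d) (h : 0 < b.height (u⁻¹ • γ)) (h' : b.height (u⁻¹ • refl P d • γ) < 0) :
    d = γ ∨ (d ≠ γ ∧ 0 < P.pairingIn ℤ γ d ∧ 0 < b.height d ∧ 0 < b.height (refl P d • γ)) := by
  refine or_iff_not_imp_left.2 fun hdγ ↦ ⟨hdγ, ?_⟩
  have hγ0 := hU.height_pos γ hγ
  obtain ⟨hd0, hd⟩ := hd
  set p := P.pairingIn ℤ γ d with hp
  have hγu : b.height (u⁻¹ • refl P d • γ) = b.height (u⁻¹ • γ) - p * b.height (u⁻¹ • d) :=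
    height_smul_refl_smul b u⁻¹ d γ
  have hp0 : 0 < p := by
    by_contra! hp0
    nlinarith
  refine ⟨hp0, ?_⟩
  rcases deg_cases b d with ⟨hd1, hd2⟩ | ⟨hd1, hd2⟩
  · refine ⟨hd1, ?_⟩
    have hrefl (z : ι) : refl P (u⁻¹ • d) • u⁻¹ • z = u⁻¹ • refl P d • z := by
      rw [refl_weyl_smul]
      simp only [mul_smul, inv_inv, smul_inv_smul]
    have := (length_lt_length_mul_refl b hd0 (u := u) (by rwa [smul_inv_smul])).2
      (by rw [mul_refl_inv_smul]; rw [hd2] at hd; lia) (u⁻¹ • γ)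
      (fun hn ↦ hdγ (smul_left_cancel _ hn).symm) h (by rwa [hrefl]) (by rwa [smul_inv_smul])
    rwa [hrefl, smul_inv_smul] at this
  · exfalso
    have hd3 : 0 < b.height (refl P d • d) := by rw [height_refl_smul_self]; lia
    have := hU.height_pos_of_eq hγ hu (τ := refl P d • γ) (i := refl P d • d) (j := γ) (a := p)
      (c := 0) (by rw [root_refl_smul_self, root_refl_smul]; module) hp0.le le_rfl hd3 hγ0
      (fun hn ↦ by
        have := congrArg b.height hn
        rw [height_refl_smul] at this
        nlinarith)
    lia

end Edges

/-! ### Potentials and their extension by folding. -/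

section Potential

variable [CharZero R] [Finite ι] [P.IsCrystallographic] (b : P.Base)

theorem IsBruhatEdge.isEdge {b : P.Base} {u v : P.weylGroup} {x : ι}
    (h : IsBruhatEdge b u v x) :
    v = refl P (u • x) * u ∧ IsEdge b u (u • x) ∧ deg b (u • x) = 0 := by
  obtain ⟨hx, rfl, hl⟩ := h
  have hv : u * refl P x = refl P (u • x) * u := by rw [← mul_refl_inv_smul, inv_smul_smul]
  have hux : 0 < b.height (u • x) := by
    by_contra! hneg
    have hneg' := b.height_ne_zero (u • x)
    have := (length_lt_length_mul_refl b hx (u := u * refl P x) (by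
      rw [mul_smul, height_smul_refl_smul_self]; lia)).1
    rw [mul_assoc, refl_mul_self, mul_one] at this
    lia
  refine ⟨hv, ⟨by rwa [inv_smul_smul], ?_⟩, deg_of_pos hux⟩
  rw [deg_of_pos hux, ← hv, hl]
  simp

theorem isQuantumEdge_iff {b : P.Base} {u v : P.weylGroup} {x : ι} :
    IsQuantumEdge b u v x ↔ 0 < b.height x ∧ v = u * refl P x ∧
      (length b v : ℤ) + rhoPairing b x = length b u + 1 := by
  rw [IsQuantumEdge, toLinearMap_twoRho_coroot, Base.isPos_iff]
  refine and_congr_right fun _ ↦ and_congr_right fun _ ↦ ?_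
  rw [eq_sub_iff_add_eq]
  exact_mod_cast Iff.rfl

theorem IsQuantumEdge.isEdge {b : P.Base} {u v : P.weylGroup} {x : ι}
    (h : IsQuantumEdge b u v x) :
    v = refl P (u • x) * u ∧ IsEdge b u (u • x) ∧ deg b (u • x) = 1 := by
  obtain ⟨hx, rfl, hl⟩ := isQuantumEdge_iff.1 h
  have hv : u * refl P x = refl P (u • x) * u := by rw [← mul_refl_inv_smul, inv_smul_smul]
  have hux := (((length_mul_refl_add_rhoPairing_eq_iff b u hx).1 hl) x hx (by
    rw [height_refl_smul_self]; lia)).1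
  refine ⟨hv, ⟨by rwa [inv_smul_smul], ?_⟩, deg_of_neg hux⟩
  rw [deg_of_neg hux, ← hv, inv_smul_smul, one_mul, hl]

theorem IsEdge.hasPath {b : P.Base} {u w : P.weylGroup} {d : ι} {n : ℕ} {ν : CorootLattice P}
    (h : IsEdge b u d) (p : HasPath b (refl P d * u) w n ν) :
    HasPath b u w (n + 1) (deg b d • corootVec P (u⁻¹ • d) + ν) := by
  obtain ⟨hd, hl⟩ := h
  rcases deg_cases b d with ⟨hd₁, hd₂⟩ | ⟨hd₁, hd₂⟩
  · rw [hd₂, zero_smul, zero_add]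
    refine HasPath.bruhat (α := u⁻¹ • d) ⟨hd, (mul_refl_inv_smul u d).symm, ?_⟩ p
    rw [hd₂] at hl
    lia
  · rw [hd₂, one_smul]
    refine HasPath.quantum (α := u⁻¹ • d)
      (isQuantumEdge_iff.2 ⟨hd, (mul_refl_inv_smul u d).symm, ?_⟩) p
    rwa [hd₂, one_mul] at hl

/-- The cone spanned by the positive coroots. -/
def posCone : AddSubmonoid (CorootLattice P) :=
  AddSubmonoid.closure (corootVec P '' {x | 0 < b.height x})

variable {b} in
theorem corootVec_mem_posCone {x : ι} (hx : 0 < b.height x) : corootVec P x ∈ posCone b :=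
  AddSubmonoid.subset_closure (Set.mem_image_of_mem (corootVec P) hx)

variable {b} in
theorem zsmul_corootVec_mem_posCone {x : ι} (hx : 0 < b.height x) {n : ℤ} (hn : 0 ≤ n) :
    n • corootVec P x ∈ posCone b := by
  obtain ⟨k, rfl⟩ := Int.eq_ofNat_of_zero_le hn
  rw [natCast_zsmul]
  exact (posCone b).nsmul_mem (corootVec_mem_posCone hx) k

/-- `μ` is a weight function for paths to `1` starting in `V`: its values are attained, and
it decreases along each edge within `V` by at most the weight of the edge. -/
structure IsPotential (V : Set P.weylGroup) (μ : P.weylGroup → CorootLattice P) : Prop where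
  one : μ 1 = 0
  hasPath : ∀ u ∈ V, ∃ n, HasPath b u 1 n (μ u)
  edge : ∀ u ∈ V, ∀ d, IsEdge b u d → refl P d * u ∈ V →
    μ (refl P d * u) + deg b d • corootVec P (u⁻¹ • d) - μ u ∈ posCone b

variable {b} {U : Set ι} {u : P.weylGroup} {γ d : ι} {μ : P.weylGroup → CorootLattice P}

theorem IsPotential.mono {V V' : Set P.weylGroup} (h : IsPotential b V μ) (hV : V' ⊆ V) :
    IsPotential b V' μ :=
  ⟨h.one, fun u hu ↦ h.hasPath u (hV hu), fun u hu d hd hd' ↦ h.edge u (hV hu) d hd (hV hd')⟩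

variable [IsDomain R] [P.IsReduced]

/-- If `γ` is a maximal inversion of `s_d u` but no inversion of `u`, the path
`u → s_d u → s_γ s_d u` may be replaced by a path avoiding the inversion `γ`. -/
theorem IsPotential.add_mem_posCone (hμ : IsPotential b (avoiding b U) μ) (hU : IsUpper b U)
    (hγ : γ ∈ U) (hS : IsUpper b (U \ {γ})) (hu : u ∈ avoiding b (U \ {γ}))
    (hu' : refl P d * u ∈ avoiding b (U \ {γ})) (hd : IsEdge b u d)
    (h : 0 < b.height (u⁻¹ • γ)) (h' : b.height (u⁻¹ • refl P d • γ) < 0) (hdγ : d ≠ γ)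
    (hp : 0 < P.pairingIn ℤ γ d) (hd0 : 0 < b.height d) (hη : 0 < b.height (refl P d • γ)) :
    μ (refl P γ * (refl P d * u)) - corootVec P (u⁻¹ • refl P d • γ) - μ u ∈ posCone b := by
  have huU : u ∈ avoiding b U := mem_avoiding_of_diff hu h
  have hγ0 := hU.height_pos γ hγ
  have htU : refl P γ * (refl P d * u) ∈ avoiding b U :=
    hU.refl_mul_mem_avoiding_of_neg hγ hS hu' (by rwa [inv_refl_mul_smul])
  have hlen : (length b (refl P γ * (refl P d * u)) : ℤ) =
      length b u + 2 + rhoPairing b (u⁻¹ • refl P d • γ) := by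
    have h₁ := hU.length_refl_mul hγ hu' (by rwa [inv_refl_mul_smul])
    have h₂ := hd.2
    rw [deg_of_pos hd0] at h₂
    rw [inv_refl_mul_smul] at h₁
    lia
  have hdu := hd.1
  set p := P.pairingIn ℤ γ d with hp'
  set m := P.pairingIn ℤ d γ with hm'
  set η := refl P d • γ with hη'
  have hηroot : P.root η = P.root γ - p • P.root d := root_refl_smul d γ
  have hdη : P.pairingIn ℤ d η = -m := by
    rw [hη', pairingIn_refl_right, pairingIn_same]; lia
  have hηd : P.pairingIn ℤ η d = -p := by
    rw [hη', pairingIn_refl_left, pairingIn_same]; lia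
  have hpm := pairingIn_cases hdγ.symm (fun hn ↦ by
    rw [hη', refl_eq_of_root_eq_neg (show P.root d = -P.root γ by rw [hn, neg_neg]),
      height_refl_smul_self] at hη
    lia)
  rw [← hm', ← hp'] at hpm
  have hm : 0 < m := by lia
  set ζ := refl P η • d with hζ'
  have hζroot : P.root ζ = P.root d + m • P.root η := by
    rw [hζ', root_refl_smul, hdη]; module
  have hζu : b.height (u⁻¹ • ζ) = b.height (u⁻¹ • d) + m * b.height (u⁻¹ • η) := by
    rw [height_smul_of_eq b (i := d) (j := η) (a := 1) (c := m) (by rw [hζroot]; module) u⁻¹]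
    ring
  have hηu : b.height (u⁻¹ • η) = b.height (u⁻¹ • γ) - p * b.height (u⁻¹ • d) :=
    height_smul_refl_smul b u⁻¹ d γ
  have hreflη : refl P η = refl P d * refl P γ * refl P d := refl_refl_smul d γ
  -- going down along a positive root `ε` with `u⁻¹ ε < 0`
  have hdown : ∀ ε : ι, b.height (u⁻¹ • ε) < 0 → 0 < b.height (u⁻¹ • refl P ε • ε) := by
    intro ε hε
    rw [height_smul_refl_smul_self]
    lia
  have hreflneg (ε : ι) : refl P (refl P ε • ε) = refl P ε :=
    refl_eq_of_root_eq_neg (root_refl_smul_self ε)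
  have hconeg (v : P.weylGroup) (ε : ι) :
      corootVec P (v • refl P ε • ε) = -corootVec P (v • ε) := by
    rw [corootVec_smul_refl_smul, pairingIn_same]; module
  have hdegneg (ε : ι) (hε : 0 < b.height ε) : deg b (refl P ε • ε) = 1 :=
    deg_of_neg (by rw [height_refl_smul_self]; lia)
  rcases height_pos_or_neg b (u⁻¹ • ζ) with hζ | hζ
  -- The replacement path is a quantum step by `η` followed by a Bruhat step by `d`. The known total
  -- change of length makes both length bounds equalities.
  · have htarget : refl P d * (refl P η * u) = refl P γ * (refl P d * u) := by
      rw [hreflη]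
      simp only [← mul_assoc, refl_mul_self, one_mul]
    have hz := hU.refl_mul_mem_avoiding huU hη h'
    have hd₂ : 0 < b.height ((refl P η * u)⁻¹ • d) := by rwa [inv_refl_mul_smul]
    have e₁ := length_add_one_le (hdown η h')
    have e₂ := length_add_one_le hd₂
    rw [hreflneg, hdegneg η hη, rhoPairing_smul_refl_smul_self] at e₁
    rw [deg_of_pos hd0, htarget] at e₂
    have k₁ := hμ.edge u huU _ (IsEdge.of_le (hdown η h') (by
      rw [hreflneg, hdegneg η hη, rhoPairing_smul_refl_smul_self]; lia)) (by rwa [hreflneg])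
    have k₂ := hμ.edge _ hz d (IsEdge.of_le hd₂ (by rw [deg_of_pos hd0, htarget]; lia))
      (by rwa [htarget])
    rw [hreflneg, hdegneg η hη, hconeg] at k₁
    rw [deg_of_pos hd0, htarget] at k₂
    convert add_mem k₁ k₂ using 1
    module
  -- If `p = 1` then `ζ = γ + (m - 1) η`, which is `γ` or lies above it, so `u⁻¹ζ` could not be
  -- negative. Thus `p ≥ 2`, which forces `m = 1`, and the replacement path consists of two quantum
  -- steps, by `ζ` and then `η`.
  · have hp2 : p ≠ 1 := by
      intro hp1
      rcases eq_or_ne m 1 with hm1 | hm1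
      · rw [hm1] at hζu
        rw [hp1] at hηu
        lia
      · have := hU.height_pos_of_eq hγ hu (τ := ζ) (i := η) (j := η) (a := m - 1) (c := 0)
          (by rw [hζroot, hηroot, hp1]; module) (by lia) le_rfl hη hη (fun hn ↦ by
            have h₁ := height_of_eq b (a := 1) (c := m) (show P.root ζ = (1 : ℤ) • P.root d +
              m • P.root η by rw [hζroot]; module)
            have h₂ : b.height η = b.height γ - p * b.height d := height_refl_smul b d γ
            rw [hn] at h₁
            rw [hp1] at h₂
            have : 0 < (m - 1) * b.height η := mul_pos (by lia) hη
            nlinarith)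
        lia
    have hm1 : m = 1 := by lia
    have hζ0 : 0 < b.height ζ := by
      rw [height_of_eq b (i := d) (j := η) (a := 1) (c := m) (by rw [hζroot]; module)]
      nlinarith
    have hζη : P.pairingIn ℤ ζ η = 1 := by
      rw [hζ', pairingIn_refl_left, pairingIn_same, hdη]; lia
    have hηζ : P.pairingIn ℤ η ζ = p := by
      rw [hζ', pairingIn_refl_right, pairingIn_same, hηd]; lia
    have hγη : P.pairingIn ℤ γ η = 2 - p := by
      rw [hη', pairingIn_refl_right, pairingIn_same, ← hp', ← hm', hm1]; lia
    have hreflζ : refl P ζ = refl P η * refl P d * refl P η := refl_refl_smul η d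
    have htarget : refl P η * (refl P ζ * u) = refl P γ * (refl P d * u) := by
      rw [hreflζ]
      simp only [← mul_assoc, refl_mul_self, one_mul]
      rw [hreflη]
      simp only [← mul_assoc, refl_mul_self, one_mul]
    -- The root `s_η γ = γ + (p - 2) η` lies in `U`, and it equals `-s_ζ η`; so this is the
    -- positivity of the label of the second step.
    have hτ : 0 < b.height (u⁻¹ • refl P η • γ) :=
      huU _ (hU.mem_of_le γ hγ _ (RootLE.of_eq (i := η) (j := η) (a := p - 2) (c := 0)
        (by rw [root_refl_smul, hγη]; module) (by lia) le_rfl hη hη))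
    have hz := hU.refl_mul_mem_avoiding huU hζ0 hζ
    have hη₂ : 0 < b.height ((refl P ζ * u)⁻¹ • refl P η • η) := by
      rw [height_smul_refl_smul_self, inv_refl_mul_smul, height_smul_refl_smul, hηζ, hζu, hm1]
      rw [height_smul_refl_smul, hγη] at hτ
      nlinarith
    have hco : corootVec P ((refl P ζ * u)⁻¹ • refl P η • η) =
        -corootVec P (u⁻¹ • η) + corootVec P (u⁻¹ • ζ) := by
      rw [hconeg, inv_refl_mul_smul, corootVec_smul_refl_smul, hζη]
      module
    have hρ : rhoPairing b ((refl P ζ * u)⁻¹ • refl P η • η) =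
        -rhoPairing b (u⁻¹ • η) + rhoPairing b (u⁻¹ • ζ) := by
      rw [rhoPairing_smul_refl_smul_self, inv_refl_mul_smul, rhoPairing_smul_refl_smul, hζη]
      ring
    have e₁ := length_add_one_le (hdown ζ hζ)
    have e₂ := length_add_one_le hη₂
    rw [hreflneg, hdegneg ζ hζ0, rhoPairing_smul_refl_smul_self] at e₁
    rw [hreflneg, hdegneg η hη, htarget, hρ] at e₂
    have k₁ := hμ.edge u huU _ (IsEdge.of_le (hdown ζ hζ) (by
      rw [hreflneg, hdegneg ζ hζ0, rhoPairing_smul_refl_smul_self]; lia)) (by rwa [hreflneg])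
    have k₂ := hμ.edge _ hz _ (IsEdge.of_le hη₂ (by
      rw [hreflneg, hdegneg η hη, htarget, hρ]; lia)) (by rwa [hreflneg, htarget])
    rw [hreflneg, hdegneg ζ hζ0, hconeg] at k₁
    rw [hreflneg, hdegneg η hη, htarget, hco] at k₂
    convert add_mem k₁ k₂ using 1
    module

open Classical in
variable (b γ μ) in
/-- Extension of a potential by folding along the root `γ`. -/
def foldPotential (u : P.weylGroup) : CorootLattice P :=
  if 0 < b.height (u⁻¹ • γ) then μ u else μ (refl P γ * u) - corootVec P (u⁻¹ • γ)

theorem foldPotential_of_pos (h : 0 < b.height (u⁻¹ • γ)) : foldPotential b γ μ u = μ u :=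
  if_pos h

theorem foldPotential_of_neg (h : b.height (u⁻¹ • γ) < 0) :
    foldPotential b γ μ u = μ (refl P γ * u) - corootVec P (u⁻¹ • γ) :=
  if_neg (by lia)

/-- For an edge there are four cases. If `γ` is an inversion of neither end, nothing changes; if of
both, the edge is folded by `s_γ`. An edge losing `γ` is the folding edge itself. An edge gaining
`γ` is either its reverse or the start of a detour that can be rerouted within `avoiding b U`. -/
theorem IsPotential.fold (hμ : IsPotential b (avoiding b U) μ) (hU : IsUpper b U)
    (hγ : γ ∈ U) (hS : IsUpper b (U \ {γ})) :
    IsPotential b (avoiding b (U \ {γ})) (foldPotential b γ μ) where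
  one := by
    rw [foldPotential_of_pos (by simpa using hU.height_pos γ hγ), hμ.one]
  hasPath u hu := by
    rcases height_pos_or_neg b (u⁻¹ • γ) with h | h
    · rw [foldPotential_of_pos h]
      exact hμ.hasPath u (mem_avoiding_of_diff hu h)
    · rw [foldPotential_of_neg h]
      obtain ⟨n, hn⟩ := hμ.hasPath _ (hU.refl_mul_mem_avoiding_of_neg hγ hS hu h)
      have hγ0 := hU.height_pos γ hγ
      have hdeg : deg b (refl P γ • γ) = 1 := deg_of_neg (by rw [height_refl_smul_self]; lia)
      have hrefl := refl_eq_of_root_eq_neg (root_refl_smul_self (P := P) γ)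
      have := IsEdge.hasPath (b := b) (u := u) (d := refl P γ • γ) (w := 1) (n := n)
        (ν := μ (refl P γ * u)) ⟨by rw [height_smul_refl_smul_self]; lia, by
          have := hU.length_refl_mul hγ hu h
          rw [hrefl, hdeg, rhoPairing_smul_refl_smul_self]
          lia⟩ (by rwa [hrefl])
      refine ⟨n + 1, ?_⟩
      convert this using 1
      rw [hdeg, corootVec_smul_refl_smul, pairingIn_same]
      module
  edge u hu d hd hu' := by
    have hg (h : b.height (u⁻¹ • refl P d • γ) < 0) :
        foldPotential b γ μ (refl P d * u) =
          μ (refl P γ * (refl P d * u)) - corootVec P (u⁻¹ • refl P d • γ) := by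
      rw [foldPotential_of_neg (by rwa [inv_refl_mul_smul]), inv_refl_mul_smul]
    have hg' (h : 0 < b.height (u⁻¹ • refl P d • γ)) :
        foldPotential b γ μ (refl P d * u) = μ (refl P d * u) :=
      foldPotential_of_pos (by rwa [inv_refl_mul_smul])
    have hd0 := hd.1
    have hγ0 := hU.height_pos γ hγ
    rcases height_pos_or_neg b (u⁻¹ • γ) with h | h <;>
      rcases height_pos_or_neg b (u⁻¹ • refl P d • γ) with h' | h'
    · rw [foldPotential_of_pos h, hg' h']
      exact hμ.edge u (mem_avoiding_of_diff hu h) d hd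
        (mem_avoiding_of_diff hu' (by rwa [inv_refl_mul_smul]))
    · rw [foldPotential_of_pos h, hg h']
      rcases hU.eq_or_pos_of_isEdge hγ hu hd h h' with rfl | ⟨h₁, h₂, h₃, h₄⟩
      · rw [deg_of_pos hγ0, ← mul_assoc, refl_mul_self, one_mul, corootVec_smul_refl_smul,
          pairingIn_same]
        convert zsmul_corootVec_mem_posCone h (zero_le_one (α := ℤ)) using 1
        module
      · rw [deg_of_pos h₃, zero_smul, add_zero]
        exact hμ.add_mem_posCone hU hγ hS hu hu' hd h h' h₁ h₂ h₃ h₄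
    · rw [foldPotential_of_neg h, hg' h']
      have hdγ := hU.root_eq_neg_of_isEdge hγ hu hu' hd h h'
      rw [← (refl_smul_self_eq_iff γ d).2 hdγ,
        refl_eq_of_root_eq_neg (root_refl_smul_self (P := P) γ),
        deg_of_neg (by rw [height_refl_smul_self]; lia), corootVec_smul_refl_smul, pairingIn_same]
      convert zero_mem (posCone b) using 1
      module
    · rw [foldPotential_of_neg h, hg h']
      set m := P.pairingIn ℤ d γ with hm
      have hle := hU.deg_refl_smul_le hγ hu hu' hd0 h h'
      rw [← hm] at hle
      have huU := hU.refl_mul_mem_avoiding_of_neg hγ hS hu h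
      have huU' := hU.refl_mul_mem_avoiding_of_neg hγ hS hu' (by rwa [inv_refl_mul_smul])
      have hx : (refl P γ * u)⁻¹ • refl P γ • d = u⁻¹ • d := by
        rw [inv_refl_mul_smul, refl_smul_self_smul]
      have hu'' : refl P (refl P γ • d) * (refl P γ * u) = refl P γ * (refl P d * u) := by
        rw [refl_refl_smul, mul_assoc, ← mul_assoc _ _ u, refl_mul_self, one_mul, mul_assoc]
      have l₁ := hU.length_refl_mul hγ hu h
      have l₂ := hU.length_refl_mul hγ hu' (by rwa [inv_refl_mul_smul])
      rw [inv_refl_mul_smul, rhoPairing_smul_refl_smul, ← hm] at l₂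
      have hT := two_le_rhoPairing b hd0
      -- Combining the length formulas for the two foldings with that of the given edge leaves an
      -- excess of `(deg (s_γ d) - deg d - m) ⟨(u⁻¹d)^∨, 2ρ⟩`, which is at most zero.
      have hedge : IsEdge b (refl P γ * u) (refl P γ • d) :=
        IsEdge.of_le (by rwa [hx]) (by
          have := hd.2
          rw [hx, hu'']
          nlinarith)
      have k := hμ.edge _ huU _ hedge (by rwa [hu''])
      rw [hx, hu''] at k
      convert add_mem k (zsmul_corootVec_mem_posCone hd0 (sub_nonneg.2 hle)) using 1
      rw [corootVec_smul_refl_smul, ← hm]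
      module

theorem IsPotential.exists_extension (hU : IsUpper b U)
    (hμ : IsPotential b (avoiding b U) μ) :
    ∃ μ', IsPotential b Set.univ μ' ∧ ∀ u ∈ avoiding b U, μ' u = μ u := by
  induction hn : U.ncard generalizing U μ with
  | zero =>
    obtain rfl := (Set.ncard_eq_zero (Set.toFinite U)).1 hn
    exact ⟨μ, hμ.mono fun u _ σ hσ ↦ hσ.elim, fun _ _ ↦ rfl⟩
  | succ n ih =>
    -- A root of least height lies above no other element of `U`, so removing it keeps `U` upward
    -- closed.
    obtain ⟨γ, hγ, hmin⟩ := Set.exists_min_image U b.height (Set.toFinite U)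
      ((Set.ncard_pos (Set.toFinite U)).1 (by lia))
    have hS : IsUpper b (U \ {γ}) := by
      refine ⟨fun σ hσ ↦ hU.height_pos σ hσ.1, fun σ hσ τ hτ ↦ ⟨hU.mem_of_le σ hσ.1 τ hτ, ?_⟩⟩
      rintro rfl
      rcases hτ.eq_or_height_lt with rfl | hlt
      · exact hσ.2 rfl
      · have := hmin σ hσ.1
        lia
    obtain ⟨μ', hμ', heq⟩ := ih hS (hμ.fold hU hγ hS) (by
      rw [Set.ncard_sdiff_singleton_of_mem hγ, hn]; rfl)
    refine ⟨μ', hμ', fun u hu ↦ ?_⟩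
    rw [heq u (avoiding_subset_diff hu), foldPotential_of_pos (hu γ hγ)]

theorem exists_isPotential_univ (b : P.Base) : ∃ μ, IsPotential b Set.univ μ := by
  have hU : IsUpper b {σ | 0 < b.height σ} := by
    refine ⟨fun σ hσ ↦ hσ, fun σ hσ τ hτ ↦ ?_⟩
    rcases hτ.eq_or_height_lt with rfl | hlt
    · exact hσ
    · exact lt_trans hσ hlt
  have hone : ∀ u ∈ avoiding b {σ | 0 < b.height σ}, u = 1 := fun u hu ↦
    inv_eq_one.1 (eq_one_of_forall_height_pos b hu)
  have hμ : IsPotential b (avoiding b {σ | 0 < b.height σ}) fun _ ↦ 0 := by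
    refine ⟨rfl, fun u hu ↦ ⟨0, ?_⟩, fun u hu d hd hd' ↦ ?_⟩
    · rw [hone u hu]
      exact HasPath.nil 1
    · have := (hone _ hd').trans (hone u hu).symm
      obtain ⟨hd0, hd⟩ := hd
      rw [add_sub_assoc, sub_zero, zero_add]
      refine zsmul_corootVec_mem_posCone hd0 ?_
      rcases deg_cases b d with h | h <;> lia
  obtain ⟨μ, hμ, -⟩ := hμ.exists_extension hU
  exact ⟨μ, hμ⟩

end Potential

/-! ### Shortest paths to `1` are those whose weight is the potential. -/

section ShortestPaths

variable [CharZero R] [Finite ι] [P.IsCrystallographic] {b : P.Base}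

/-- The length conditions on the edges telescope, so among paths with given ends, fewer edges means
smaller pairing of the weight with `2ρ`. -/
theorem HasPath.length_eq {u w : P.weylGroup} {n : ℕ} {ν : CorootLattice P}
    (p : HasPath b u w n ν) :
    (n : R) + length b u = length b w + P.toLinearMap (twoRho b) ν := by
  induction p with
  | nil w => simp
  | bruhat e p ih =>
    rw [e.2.2] at ih
    push_cast at ih ⊢
    linear_combination ih
  | @quantum w₁ w₂ w₃ α n ν e p ih =>
    rw [e.2.2] at ih
    have : P.toLinearMap (twoRho b) ((corootVec P α + ν : CorootLattice P) : N) =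
        P.toLinearMap (twoRho b) (P.coroot α) + P.toLinearMap (twoRho b) ν := by
      rw [← map_add]; rfl
    rw [this]
    push_cast
    linear_combination ih

theorem exists_toLinearMap_twoRho_eq_natCast {ν : CorootLattice P} (h : ν ∈ posCone b) :
    ∃ k : ℕ, P.toLinearMap (twoRho b) ν = k ∧ (k = 0 → ν = 0) := by
  induction h using AddSubmonoid.closure_induction with
  | mem x hx =>
    obtain ⟨α, hα, rfl⟩ := hx
    have := two_le_rhoPairing b hα
    refine ⟨(rhoPairing b α).toNat, ?_, fun h ↦ by lia⟩
    change P.toLinearMap (twoRho b) (P.coroot α) = _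
    rw [toLinearMap_twoRho_coroot, ← Int.cast_natCast, Int.toNat_of_nonneg (by lia)]
  | zero => exact ⟨0, by simp, fun _ ↦ rfl⟩
  | add x y _ _ hx hy =>
    obtain ⟨k, hk, hk'⟩ := hx
    obtain ⟨l, hl, hl'⟩ := hy
    refine ⟨k + l, ?_, fun h ↦ by rw [hk' (by lia), hl' (by lia), add_zero]⟩
    rw [Submodule.coe_add, map_add, hk, hl, Nat.cast_add]

variable {μ : P.weylGroup → CorootLattice P}

theorem IsPotential.sub_mem_posCone (hμ : IsPotential b Set.univ μ) {u w : P.weylGroup} {n : ℕ}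
    {ν : CorootLattice P} (p : HasPath b u w n ν) : ν + μ w - μ u ∈ posCone b := by
  induction p with
  | nil w => simp
  | @bruhat w₁ w₂ w₃ α n ν e p ih =>
    obtain ⟨hv, he, hdeg⟩ := e.isEdge
    have := hμ.edge _ trivial _ he trivial
    rw [hdeg, ← hv] at this
    convert add_mem ih this using 1
    module
  | @quantum w₁ w₂ w₃ α n ν e p ih =>
    obtain ⟨hv, he, hdeg⟩ := e.isEdge
    have := hμ.edge _ trivial _ he trivial
    rw [hdeg, ← hv, inv_smul_smul] at this
    convert add_mem ih this using 1
    module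

theorem IsPotential.isShortestWeight_iff (hμ : IsPotential b Set.univ μ) (u : P.weylGroup)
    (ν : CorootLattice P) : IsShortestWeight b u 1 ν ↔ ν = μ u := by
  have key {n n' : ℕ} {ν : CorootLattice P} (p : HasPath b u 1 n (μ u))
      (p' : HasPath b u 1 n' ν) : n ≤ n' ∧ (n = n' → ν = μ u) := by
    have hc := hμ.sub_mem_posCone p'
    rw [hμ.one, add_zero] at hc
    obtain ⟨k, hk, hk'⟩ := exists_toLinearMap_twoRho_eq_natCast hc
    rw [Submodule.coe_sub, map_sub] at hk
    have hn : (n' : R) = (n + k : ℕ) := by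
      push_cast
      linear_combination p'.length_eq - p.length_eq + hk
    have hn' : n' = n + k := Nat.cast_injective hn
    exact ⟨by lia, fun h ↦ sub_eq_zero.1 (hk' (by lia))⟩
  obtain ⟨n, p⟩ := hμ.hasPath u trivial
  have hdist : dist b u 1 = n := by
    apply le_antisymm
    · exact iInf₂_le n ⟨μ u, p⟩
    · refine le_iInf₂ fun n' hn' ↦ ?_
      obtain ⟨ν', p'⟩ := hn'
      exact_mod_cast (key p p').1
  constructor
  · rintro ⟨n', p', hn'⟩
    rw [hdist] at hn'
    exact (key p p').2 (by exact_mod_cast hn'.symm)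
  · rintro rfl
    exact ⟨n, p, hdist.symm⟩

theorem IsPotential.existsUnique_isShortestWeight (hμ : IsPotential b Set.univ μ)
    (u : P.weylGroup) : ∃! ν, IsShortestWeight b u 1 ν :=
  ⟨μ u, (hμ.isShortestWeight_iff u _).2 rfl, fun _ h ↦ (hμ.isShortestWeight_iff u _).1 h⟩

theorem IsPotential.wt_eq (hμ : IsPotential b Set.univ μ) (u : P.weylGroup) :
    wt b u 1 = μ u := by
  have h : ∃ ν, IsShortestWeight b u 1 ν := (hμ.existsUnique_isShortestWeight u).exists
  rw [wt, dif_pos h]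
  exact (hμ.isShortestWeight_iff u _).1 h.choose_spec

end ShortestPaths

/-! ### Maximal inversions and the recursion. -/

section MaximalInversions

variable [CharZero R] [Finite ι] [IsDomain R] [P.IsCrystallographic] [P.IsReduced] {b : P.Base}

theorem isUpper_of_height_pos {γ : ι} (hγ : 0 < b.height γ) :
    IsUpper b {τ | RootLE b γ τ} := by
  refine ⟨fun σ hσ ↦ ?_, fun σ hσ τ hτ ↦ ?_⟩
  · rcases hσ.eq_or_height_lt with rfl | h
    · exact hγ
    · exact hγ.trans h
  · have := add_mem hτ hσ
    rwa [sub_add_sub_cancel] at this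

theorem isUpper_diff_of_height_pos {γ : ι} (hγ : 0 < b.height γ) :
    IsUpper b ({τ | RootLE b γ τ} \ {γ}) := by
  have hU := isUpper_of_height_pos hγ
  refine ⟨fun σ hσ ↦ hU.height_pos σ hσ.1, fun σ hσ τ hτ ↦ ⟨hU.mem_of_le σ hσ.1 τ hτ, ?_⟩⟩
  rintro rfl
  rcases hσ.1.eq_or_height_lt with rfl | h₁
  · exact hσ.2 rfl
  · rcases hτ.eq_or_height_lt with rfl | h₂ <;> lia

variable {w : P.weylGroup} {γ : ι}

/-- Maximality of `γ` says exactly that no other root above `γ` is an inversion, which puts `w` in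
the domain of the folding along `γ`. -/
theorem mem_avoiding_of_mem_maxInv (hγ : γ ∈ maxInv b w) :
    w ∈ avoiding b ({τ | RootLE b γ τ} \ {γ}) := by
  intro σ hσ
  by_contra h
  exact hγ.2 ⟨σ, ⟨(isUpper_of_height_pos hγ.1.1).height_pos σ hσ.1, h⟩, hσ.2, hσ.1⟩

theorem self_mem_rootLE (b : P.Base) (γ : ι) : γ ∈ {τ | RootLE b γ τ} := by
  rw [Set.mem_ofPred_eq, RootLE, sub_self]
  exact zero_mem _

theorem height_inv_smul_neg_of_mem_maxInv (hγ : γ ∈ maxInv b w) :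
    b.height (w⁻¹ • γ) < 0 :=
  (height_pos_or_neg b _).resolve_left hγ.1.2

theorem length_refl_mul_of_mem_maxInv (hγ : γ ∈ maxInv b w) :
    (length b (refl P γ * w) : ℤ) - rhoPairing b (w⁻¹ • γ) = length b w + 1 :=
  (isUpper_of_height_pos hγ.1.1).length_refl_mul (self_mem_rootLE b γ)
    (mem_avoiding_of_mem_maxInv hγ) (height_inv_smul_neg_of_mem_maxInv hγ)

theorem isQuantumEdge_of_mem_maxInv (hγ : γ ∈ maxInv b w) :
    IsQuantumEdge b w (refl P γ * w) (w⁻¹ • refl P γ • γ) := by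
  have h := height_inv_smul_neg_of_mem_maxInv hγ
  have hl := length_refl_mul_of_mem_maxInv hγ
  refine isQuantumEdge_iff.2 ⟨by rw [height_smul_refl_smul_self]; lia, ?_, ?_⟩
  · rw [mul_refl_inv_smul, refl_eq_of_root_eq_neg (root_refl_smul_self (P := P) γ)]
  · rw [rhoPairing_smul_refl_smul_self]
    lia

theorem length_refl_mul_lt_of_mem_maxInv (hγ : γ ∈ maxInv b w) :
    length b (refl P γ * w) < length b w := by
  have h := height_inv_smul_neg_of_mem_maxInv hγ
  have hl := length_refl_mul_of_mem_maxInv hγ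
  have hT := two_le_rhoPairing b (x := w⁻¹ • refl P γ • γ)
    (by rw [height_smul_refl_smul_self]; lia)
  rw [rhoPairing_smul_refl_smul_self] at hT
  lia

/-- Folding `wt` along `γ` and extending gives a second global potential, which must again be `wt`;
the formula is its value at `w`. -/
theorem wt_eq_of_mem_maxInv (hγ : γ ∈ maxInv b w) :
    wt b w 1 = wt b (refl P γ * w) 1 - corootVec P (w⁻¹ • γ) := by
  obtain ⟨μ, hμ⟩ := exists_isPotential_univ b
  have hS := isUpper_diff_of_height_pos hγ.1.1
  have hfold := (hμ.mono (Set.subset_univ _)).fold (isUpper_of_height_pos hγ.1.1)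
    (self_mem_rootLE b γ) hS
  obtain ⟨μ', hμ', heq⟩ := hfold.exists_extension hS
  rw [hμ'.wt_eq w, heq w (mem_avoiding_of_mem_maxInv hγ), hμ.wt_eq,
    foldPotential_of_neg (height_inv_smul_neg_of_mem_maxInv hγ)]

theorem maxInv_nonempty (hw : w ≠ 1) : (maxInv b w).Nonempty := by
  have hinv : (inv b w).Nonempty := by
    by_contra! h
    refine hw (inv_eq_one.1 (eq_one_of_forall_height_pos b fun z hz ↦ ?_))
    by_contra hz'
    have : z ∈ inv b w := ⟨hz, hz'⟩
    rw [h] at this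
    exact this
  obtain ⟨γ, hγ, hmax⟩ := Set.exists_max_image (inv b w) b.height (Set.toFinite _) hinv
  refine ⟨γ, hγ, ?_⟩
  rintro ⟨α, hα, hne, hle⟩
  rcases hle.eq_or_height_lt with rfl | h
  · exact hne rfl
  · have := hmax α hα
    lia

end MaximalInversions

end QuantumBruhat

end

theorem mainTheorem10 {ι R M N : Type*} [Finite ι] [CommRing R] [IsDomain R] [CharZero R]
    [AddCommGroup M] [Module R M] [AddCommGroup N] [Module R N]
    (P : RootPairing ι R M N) [P.IsCrystallographic] [P.IsReduced] (b : P.Base)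
    (w : P.weylGroup) :
    (∀ γ ∈ QuantumBruhat.maxInv b w,
      (∃ α : ι, QuantumBruhat.IsQuantumEdge b w (QuantumBruhat.refl P γ * w) α) ∧
      (∃! μ, QuantumBruhat.IsShortestWeight b w 1 μ) ∧
      (∃! μ, QuantumBruhat.IsShortestWeight b (QuantumBruhat.refl P γ * w) 1 μ) ∧
      QuantumBruhat.wt b w 1 =
        QuantumBruhat.wt b (QuantumBruhat.refl P γ * w) 1 - QuantumBruhat.corootVec P (w⁻¹ • γ) ∧
      QuantumBruhat.length b (QuantumBruhat.refl P γ * w) < QuantumBruhat.length b w) ∧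
    (w ≠ 1 → (QuantumBruhat.maxInv b w).Nonempty) ∧
    QuantumBruhat.wt b 1 1 = 0 := by
  obtain ⟨μ, hμ⟩ := QuantumBruhat.exists_isPotential_univ b
  exact ⟨fun γ hγ ↦ ⟨⟨_, QuantumBruhat.isQuantumEdge_of_mem_maxInv hγ⟩,
    hμ.existsUnique_isShortestWeight w, hμ.existsUnique_isShortestWeight _,
    QuantumBruhat.wt_eq_of_mem_maxInv hγ, QuantumBruhat.length_refl_mul_lt_of_mem_maxInv hγ⟩,
    QuantumBruhat.maxInv_nonempty, by rw [hμ.wt_eq, hμ.one]⟩
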